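/- Let $D>0$ and $m>0$ be real numbers, put $d=D+m$, $\epsilon=D-2+\tfrac m2$, $a=2-\epsilon=4-D-\tfrac m2$, $b=\tfrac{3-D}{2}$, and assume $0<\epsilon<2$. For $p\ge 0$, $q>0$ put $X=4p^2/q^4$ and consider $$I_{D,m}(p,q)=\int\frac{d^mq'}{(2\pi)^m}\int\frac{d^Dp'}{(2\pi)^D}\,\frac{1}{p'^2+q'^4}\,\frac{1}{|\boldsymbol p'+\boldsymbol p|^2+|\boldsymbol q'+\boldsymbol q|^4},\qquad |\boldsymbol p|=p,\ |\boldsymbol q|=q .$$ For positive integers $D,m$ this is the Lebesgue integral over $\mathbb R^m\oplus\mathbb R^D$. For real dimension $\nu>0$ the integral over $\boldsymbol k$ of a function $f(x,u)$ of the component $x$ of $\boldsymbol k$ along a fixed axis and of the squared length $u$ of the orthogonal component is $$\int d^\nu k\, f=-\frac{\pi^{(\nu-1)/2}}{\Gamma(\frac{\nu+1}2)}\int_{-\infty}^\infty dx\int_0^\infty u^{(\nu-1)/2}\,\partial_uf(x,u)\,du ,$$ which is the analytic continuation in $\nu$ of the usual formula in polar coordinates. Let $$A_{D,m}=\frac{8}{(16\pi)^{(d-1)/2}}\,\frac{\Gamma(2-\epsilon)}{\Gamma(\frac{5-D}{2})},\qquad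 B_n=\frac{(\frac12)_n(a)_n(b)_n}{(\frac32)_n(b+1)_n\,n!}.$$ Then for $X<1$ the integral and the series below converge absolutely, and $$I_{D,m}(p,q)=A_{D,m}\,q^{-4+2\epsilon}\sum_{n=0}^\infty B_n\;{}_3F_2\!\left(\begin{matrix}1,\ \tfrac12(a+n),\ \tfrac12(a+n+1)\\ \tfrac32+n,\ b+1+n\end{matrix};-X\right).$$ -/

import Mathlib

open MeasureTheory Set Filter Topology

noncomputable section

namespace AnisotropicLoop

/-! ### Integration in a real number of dimensions

An integrand on `D`-dimensional Euclidean space that is rotationally symmetric about a fixed axis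
has the form `k ↦ f x u`, where `x` is the coordinate of `k` along the axis and `u` is the square
of the length of the component of `k` orthogonal to the axis, which ranges over a space of
dimension `n = D - 1`.  For integral `n ≥ 1`, polar coordinates give
`∫ g(|v|²) dⁿv = π^(n/2) / Γ(n/2) * ∫₀^∞ u^(n/2-1) g(u) du`.  One integration by parts turns the
right-hand side into
`- π^(n/2) / Γ(n/2+1) * ∫₀^∞ u^(n/2) g'(u) du`,
which makes sense for all real `n > -2`, equals `g(0)` for `n = 0` and is analytic in `n`.  This is
the standard definition of the integral in a real number of dimensions (the analytic continuation
of the formula in polar coordinates). -/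

/-- Transversal part: the integral of `v ↦ g (|v|²)` over a space of real dimension `n > -2`. -/
def radialIntegral (n : ℝ) (g : ℝ → ℝ) : ℝ :=
  -(Real.pi ^ (n / 2) / Real.Gamma (n / 2 + 1)) *
    ∫ u in Ioi (0 : ℝ), u ^ (n / 2) * deriv g u

/-- For `n > 0`, `radialIntegral` is the usual integral in polar coordinates. -/
theorem radialIntegral_of_pos {n : ℝ} (hn : 0 < n) {g : ℝ → ℝ}
    (hg : ∀ u, 0 < u → DifferentiableAt ℝ g u)
    (h1 : IntegrableOn (fun u => u ^ (n / 2) * deriv g u) (Ioi 0))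
    (h2 : IntegrableOn (fun u => u ^ (n / 2 - 1) * g u) (Ioi 0))
    (h3 : Tendsto (fun u => u ^ (n / 2) * g u) (𝓝[>] 0) (𝓝 0))
    (h4 : Tendsto (fun u => u ^ (n / 2) * g u) atTop (𝓝 0)) :
    radialIntegral n g =
      2 * Real.pi ^ (n / 2) / Real.Gamma (n / 2) *
        ∫ r in Ioi (0 : ℝ), r ^ (n - 1) * g (r ^ 2) := by
  have key : ∫ u in Ioi (0 : ℝ), u ^ (n / 2) * deriv g u =
      0 - 0 - ∫ u in Ioi (0 : ℝ), (n / 2 * u ^ (n / 2 - 1)) * g u := by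
    refine integral_Ioi_mul_deriv_eq_deriv_mul (fun x hx => ?_)
      (fun x hx => (hg x hx).hasDerivAt) h1 ?_ h3 h4
    · exact Real.hasDerivAt_rpow_const (Or.inl (ne_of_gt hx))
    · have := h2.const_mul (n / 2)
      refine this.congr (ae_of_all _ fun x => ?_)
      simp only [Pi.mul_apply]; ring
  have sub : ∫ r in Ioi (0 : ℝ), r ^ (n - 1) * g (r ^ 2) =
      2⁻¹ * ∫ u in Ioi (0 : ℝ), u ^ (n / 2 - 1) * g u := by
    rw [← integral_comp_rpow_Ioi_of_pos (p := 2) (g := fun u => u ^ (n / 2 - 1) * g u) two_pos,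
      ← integral_const_mul]
    refine setIntegral_congr_fun measurableSet_Ioi fun x hx => ?_
    have hx' : (0 : ℝ) < x := hx
    have e : x ^ (n - 1) = x ^ ((2 : ℝ) - 1) * (x ^ (2 : ℝ)) ^ (n / 2 - 1) := by
      rw [← Real.rpow_mul hx'.le, ← Real.rpow_add hx']; congr 1; ring
    have e2 : x ^ (2 : ℝ) = x ^ 2 := Real.rpow_two x
    simp only [smul_eq_mul]
    rw [e, e2]; ring
  have hΓ : Real.Gamma (n / 2 + 1) = n / 2 * Real.Gamma (n / 2) :=
    Real.Gamma_add_one (by positivity)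
  have hΓ0 : Real.Gamma (n / 2) ≠ 0 := (Real.Gamma_pos_of_pos (by positivity)).ne'
  have e3 : ∫ u in Ioi (0 : ℝ), (n / 2 * u ^ (n / 2 - 1)) * g u =
      n / 2 * ∫ u in Ioi (0 : ℝ), u ^ (n / 2 - 1) * g u := by
    rw [← integral_const_mul]; congr 1; ext u; ring
  rw [radialIntegral, key, sub, e3, hΓ]
  field_simp
  ring

/-- For `n = 0`, `radialIntegral` is evaluation at the only point of the space. -/
theorem radialIntegral_zero {g : ℝ → ℝ}
    (hg : ∀ u, 0 < u → DifferentiableAt ℝ g u) (h0 : ContinuousWithinAt g (Ici 0) 0)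
    (h1 : IntegrableOn (deriv g) (Ioi 0)) (h2 : Tendsto g atTop (𝓝 0)) :
    radialIntegral 0 g = g 0 := by
  have := integral_Ioi_of_hasDerivAt_of_tendsto h0 (fun x hx => (hg x hx).hasDerivAt) h1 h2
  simp [radialIntegral, this]

/-- The integral of the axially symmetric integrand `f` (see above) over a Euclidean space of real
dimension `D > -1`: the coordinate along the axis runs over `ℝ`, the transversal space has
dimension `D - 1`. -/
def dimIntegral (D : ℝ) (f : ℝ → ℝ → ℝ) : ℝ :=
  ∫ x : ℝ, radialIntegral (D - 1) (f x)

/-- Absolute convergence of `dimIntegral D f`. -/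
def DimIntegrable (D : ℝ) (f : ℝ → ℝ → ℝ) : Prop :=
  (∀ᵐ x : ℝ, ∀ u, 0 < u → DifferentiableAt ℝ (f x) u) ∧
  (∀ᵐ x : ℝ, Tendsto (f x) atTop (𝓝 0)) ∧
  Integrable (fun z : ℝ × ℝ => z.2 ^ ((D - 1) / 2) * deriv (f z.1) z.2)
    ((volume : Measure ℝ).prod (volume.restrict (Ioi (0 : ℝ))))

/-! ### The Feynman integral -/

/-- Integrand of the inner integral over `p'`, with axis along the external momentum of length `p`
and with squared masses `M₁`, `M₂`:
`1 / (p'² + M₁) * 1 / (|p' + p|² + M₂)`, where `p'² = x² + u`. -/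
def innerIntegrand (p M₁ M₂ : ℝ) (x u : ℝ) : ℝ :=
  1 / (x ^ 2 + u + M₁) * (1 / ((x + p) ^ 2 + u + M₂))

/-- The inner integral `∫ d^D p' / (2π)^D` in real dimension `D`. -/
def innerIntegral (D p M₁ M₂ : ℝ) : ℝ :=
  1 / (2 * Real.pi) ^ D * dimIntegral D (innerIntegrand p M₁ M₂)

/-- Integrand of the outer integral over `q'`, with axis along the external momentum of length `q`:
here `q'² = y² + v`, and the squared masses are `q'⁴` and `|q' + q|⁴`. -/
def outerIntegrand (D p q : ℝ) (y v : ℝ) : ℝ :=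
  innerIntegral D p ((y ^ 2 + v) ^ 2) (((y + q) ^ 2 + v) ^ 2)

/-- The integral `I_{D,m}(p,q)` for real dimensions `D` and `m`. -/
def loopIntegral (D m p q : ℝ) : ℝ :=
  1 / (2 * Real.pi) ^ m * dimIntegral m (outerIntegrand D p q)

/-- Absolute convergence of `I_{D,m}(p,q)`: of the inner integral for every `q' = (y, v)` off the
axis, and of the outer integral. -/
def LoopConvergent (D m p q : ℝ) : Prop :=
  (∀ y v : ℝ, 0 < v →
    DimIntegrable D (innerIntegrand p ((y ^ 2 + v) ^ 2) (((y + q) ^ 2 + v) ^ 2))) ∧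
  DimIntegrable m (outerIntegrand D p q)

/-- The Feynman integrand on `ℝ^m ⊕ ℝ^D` for positive integers `D`, `m`, as a function of
`(q', p')`. -/
def euclideanIntegrand {D m : ℕ} (p : EuclideanSpace ℝ (Fin D)) (q : EuclideanSpace ℝ (Fin m))
    (z : EuclideanSpace ℝ (Fin m) × EuclideanSpace ℝ (Fin D)) : ℝ :=
  1 / (‖z.2‖ ^ 2 + ‖z.1‖ ^ 4) * (1 / (‖z.2 + p‖ ^ 2 + ‖z.1 + q‖ ^ 4))

/-- The Feynman integral over `ℝ^m ⊕ ℝ^D` with Lebesgue measure, for positive integers `D`, `m`. -/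
def euclideanLoopIntegral {D m : ℕ} (p : EuclideanSpace ℝ (Fin D))
    (q : EuclideanSpace ℝ (Fin m)) : ℝ :=
  1 / (2 * Real.pi) ^ m * ∫ q' : EuclideanSpace ℝ (Fin m),
    1 / (2 * Real.pi) ^ D * ∫ p' : EuclideanSpace ℝ (Fin D), euclideanIntegrand p q (q', p')

/-! ### Parameters and the hypergeometric function -/

/-- `ε = D - 2 + m/2`. -/
def eps (D m : ℝ) : ℝ := D - 2 + m / 2

/-- `X = 4 p² / q⁴`. -/
def bigX (p q : ℝ) : ℝ := 4 * p ^ 2 / q ^ 4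

/-- `a = 4 - D - m/2 = 2 - ε`. -/
def parA (D m : ℝ) : ℝ := 4 - D - m / 2

/-- `b = (3 - D)/2`. -/
def parB (D : ℝ) : ℝ := (3 - D) / 2

/-- `A_{D,m} = 8 / (16π)^((d-1)/2) * Γ(2-ε) / Γ((5-D)/2)`, with `d = D + m`. -/
def coeffA (D m : ℝ) : ℝ :=
  8 / (16 * Real.pi) ^ ((D + m - 1) / 2) *
    (Real.Gamma (2 - eps D m) / Real.Gamma ((5 - D) / 2))

/-- Pochhammer symbol `(x)_n = x (x+1) ⋯ (x+n-1)`. -/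
def poch (x : ℝ) (n : ℕ) : ℝ := (ascPochhammer ℝ n).eval x

/-- `B_n = (1/2)_n (a)_n (b)_n / ((3/2)_n (b+1)_n n!)`. -/
def coeffB (D m : ℝ) (n : ℕ) : ℝ :=
  poch (1 / 2) n * poch (parA D m) n * poch (parB D) n /
    (poch (3 / 2) n * poch (parB D + 1) n * (n.factorial : ℝ))

/-- `k`-th term of the hypergeometric series `₃F₂(a₁, a₂, a₃; b₁, b₂; z)`. -/
def hyp32Term (a₁ a₂ a₃ b₁ b₂ z : ℝ) (k : ℕ) : ℝ :=
  poch a₁ k * poch a₂ k * poch a₃ k / (poch b₁ k * poch b₂ k * (k.factorial : ℝ)) * z ^ k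

/-- The hypergeometric function `₃F₂(a₁, a₂, a₃; b₁, b₂; z)`, as the sum of its series. -/
def hyp32 (a₁ a₂ a₃ b₁ b₂ z : ℝ) : ℝ := ∑' k : ℕ, hyp32Term a₁ a₂ a₃ b₁ b₂ z k

end AnisotropicLoop

end

open AnisotropicLoop

namespace AnisotropicLoop

/-! ### Pochhammer symbols and the double series -/

/-! Put `l = (4 - D)/2`, `κ₁ = |q'|²`, `κ₂ = |q' + q|²`. Feynman's parametrization turns the
integral over `p'` into `π^(D/2) Γ(l)` times `massIntegral`, that is `∫₀¹ (s(1-s)p² + sκ₁² +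
(1-s)κ₂²)^(-l) ds` (`dimIntegral_innerIntegrand`, `lintegral_euclidean_inner`). With the half sum
`S` and half difference `δ` of `κ₁`, `κ₂`, and `z = δ/S`, the bracket equals `S² (1 + 2(2s-1)z + z²
+ 4s(1-s) p²/(4S²))`. Binomial expansion in `p²/(4S²)` leaves weighted means of powers of `1 +
2(2s-1)z + z²`. By a quadratic transformation (`hasSum_meanCoeff`) these are power series in `z²`,
so `massIntegral` is a double series in `p^(2k) δ^(2n) S^(-2(l+k+n))` (`hasSum_massTerm`).

The choice of `S` and `δ` pays off in the outer integral: with `Q = q' + q/2` one has `S = |Q|² +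
q²/4` and `δ = -Q·q`, so each term integrates to a product of Gamma functions (`momentWeight`). The
duplication formula turns these products into `doubleTerm` (`massCoeff_mul_momentWeight`), and
summation over `k` at fixed `n` gives `B_n` times the `₃F₂`.

As to convergence, `S ≥ q²/4` and `X < 1` give `p² < 4S²`, while `|δ| < S` as long as both masses
are positive. Up to a constant factor each term is nonnegative in the integration variables, so its
`L¹` norm is a fixed multiple of `|doubleTerm|`. These are summable because `B_n = O(n^(a-3))` with
`a < 2` and the `k`-th term of the `₃F₂` is at most `X^k`. This justifies termwise integration and
yields absolute convergence of the integral as well.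

In real dimension the definition contains a derivative in the squared transversal length `v`; only
`S` depends on `v`, and the series is differentiated term by term (`hasDerivAt_massIntegral_outer`).
Integer dimensions are treated directly with Lebesgue measure, and both routes end in the same
double series. -/

@[simp] theorem poch_zero (x : ℝ) : poch x 0 = 1 := by simp [poch]

theorem poch_succ (x : ℝ) (n : ℕ) : poch x (n + 1) = poch x n * (x + n) := by
  simp [poch, ascPochhammer_succ_eval]

theorem poch_succ_left (x : ℝ) (n : ℕ) : poch x (n + 1) = x * poch (x + 1) n := by
  induction n with
  | zero => simp [poch_succ]
  | succ n ih => rw [poch_succ, ih, poch_succ]; push_cast; ring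

theorem poch_pos {x : ℝ} (hx : 0 < x) (n : ℕ) : 0 < poch x n := ascPochhammer_pos n x hx

theorem poch_add (x : ℝ) (n k : ℕ) : poch x (n + k) = poch x n * poch (x + n) k := by
  induction k with
  | zero => simp
  | succ k ih => rw [← add_assoc, poch_succ, ih, poch_succ]; push_cast; ring

/-- The division-free form of `(x)_n / (x+1)_n = x / (x+n)`. -/
theorem poch_mul_add (x : ℝ) (n : ℕ) : poch x n * (x + n) = x * poch (x + 1) n := by
  rw [← poch_succ, poch_succ_left]

theorem poch_one (n : ℕ) : poch 1 n = n.factorial := by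
  induction n with
  | zero => simp
  | succ n ih => rw [poch_succ, ih, Nat.factorial_succ]; push_cast; ring

theorem poch_two_mul (a : ℝ) (k : ℕ) :
    poch a (2 * k) = 4 ^ k * (poch (a / 2) k * poch ((a + 1) / 2) k) := by
  induction k with
  | zero => simp
  | succ k ih =>
    rw [show 2 * (k + 1) = 2 * k + 1 + 1 by ring, poch_succ, poch_succ, ih, poch_succ, poch_succ]
    push_cast; ring

theorem Gamma_add_nat {x : ℝ} (hx : 0 < x) (n : ℕ) :
    Real.Gamma (x + n) = poch x n * Real.Gamma x := by
  induction n with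
  | zero => simp
  | succ n ih =>
    rw [Nat.cast_succ, ← add_assoc, Real.Gamma_add_one (by positivity), ih, poch_succ]; ring

/-- The upper parameter `1` cancels `k!`, and the other two upper parameters are dominated by the
lower ones, so every coefficient is at most one. -/
theorem abs_hyp32Term_le {a₁ a₂ b₁ b₂ X : ℝ} (h1 : 0 ≤ a₁) (h2 : 0 ≤ a₂) (hb1 : 0 < b₁)
    (hb2 : 0 < b₂) (h1' : a₁ ≤ b₁) (h2' : a₂ ≤ b₂) (hX : 0 ≤ X) (k : ℕ) :
    |hyp32Term 1 a₁ a₂ b₁ b₂ (-X) k| ≤ X ^ k := by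
  have hp {x : ℝ} (hx : 0 ≤ x) (n : ℕ) : 0 ≤ poch x n := by
    induction n with
    | zero => simp
    | succ n ih => rw [poch_succ]; positivity
  have hle {x y : ℝ} (hx : 0 ≤ x) (hxy : x ≤ y) (n : ℕ) : poch x n ≤ poch y n := by
    induction n with
    | zero => simp
    | succ n ih =>
      rw [poch_succ, poch_succ]
      exact mul_le_mul ih (by linarith) (by positivity) (hp (hx.trans hxy) n)
  have hk : (0 : ℝ) < k.factorial := by positivity
  rw [hyp32Term, abs_mul, abs_pow, abs_neg, abs_of_nonneg hX, poch_one]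
  refine mul_le_of_le_one_left (by positivity) ?_
  have hB := mul_pos (poch_pos hb1 k) (poch_pos hb2 k)
  have hA := mul_nonneg (hp h1 k) (hp h2 k)
  rw [abs_of_nonneg (by rw [mul_assoc]; positivity)]
  rw [div_le_one (by positivity), mul_assoc, mul_comm]
  exact mul_le_mul_of_nonneg_right
    (mul_le_mul (hle h1 h1' k) (hle h2 h2' k) (hp h2 k) (poch_pos hb1 k).le) hk.le

/-- With `r_n = (a)_n / n!`, the difference `r_n/(n+1) - r_(n+1)/(n+2)` is `(2 - a)` times the
`n`-th term. The partial sums therefore telescope and stay below `1/(2 - a)`. -/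
theorem summable_poch_div_factorial {a : ℝ} (ha : 0 < a) (ha2 : a < 2) :
    Summable fun n : ℕ => poch a n / n.factorial / ((n + 1) * (n + 2)) := by
  have hr : ∀ n : ℕ, 0 < poch a n / n.factorial := fun n => div_pos (poch_pos ha n) (by positivity)
  have hs : ∀ n : ℕ, ∑ i ∈ Finset.range n, poch a i / i.factorial / ((i + 1) * (i + 2)) =
      (1 - poch a n / n.factorial / (n + 1)) / (2 - a) := by
    intro n
    have : 2 - a ≠ 0 := by linarith
    induction n with
    | zero => simp
    | succ n ih =>
      rw [Finset.sum_range_succ, ih, poch_succ, Nat.factorial_succ]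
      push_cast
      field_simp
      ring
  refine summable_of_sum_range_le (c := 1 / (2 - a)) (fun n => ?_) (fun n => ?_)
  · have := hr n; positivity
  · rw [hs]
    have := hr n
    have h2 : 0 < poch a n / n.factorial / (n + 1) := by positivity
    exact div_le_div_of_nonneg_right (by linarith) (by linarith)

/-- The two Pochhammer ratios collapse to `1/(2n+1)` and `b/(b+n)`, which leaves the series of
`summable_poch_div_factorial` up to a constant. -/
theorem summable_abs_coeffB {D m : ℝ} (hD : 0 < D) (hD4 : D < 4) (ha : 0 < parA D m)
    (ha2 : parA D m < 2) : Summable fun n : ℕ => |coeffB D m n| := by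
  refine Summable.of_nonneg_of_le (fun n => abs_nonneg _) (fun n => ?_)
    ((summable_poch_div_factorial ha ha2).mul_left 9)
  have hr : 0 < poch (parA D m) n / n.factorial := div_pos (poch_pos ha n) (by positivity)
  have hb : -(1 / 2) < parB D := by unfold parB; linarith
  have hb' : parB D < 3 / 2 := by unfold parB; linarith
  have h32 : poch (3 / 2) n ≠ 0 := (poch_pos (by norm_num) n).ne'
  have hb1 : poch (parB D + 1) n ≠ 0 := (poch_pos (by linarith) n).ne'
  rcases Nat.eq_zero_or_pos n with rfl | hn
  · simp [coeffB]; norm_num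
  have hn1 : (1 : ℝ) ≤ n := by exact_mod_cast hn
  have e1 : poch (1 / 2) n / poch (3 / 2) n = 1 / (2 * n + 1) := by
    have := poch_mul_add (1 / 2) n
    rw [show (1 / 2 : ℝ) + 1 = 3 / 2 by norm_num] at this
    rw [div_eq_div_iff h32 (by positivity)]; linarith
  have e2 : poch (parB D) n / poch (parB D + 1) n = parB D / (parB D + n) := by
    rw [div_eq_div_iff hb1 (by linarith)]; exact poch_mul_add _ _
  have e : coeffB D m n = poch (1 / 2) n / poch (3 / 2) n *
      (poch (parB D) n / poch (parB D + 1) n) * (poch (parA D m) n / n.factorial) := by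
    rw [coeffB]; field_simp
  rw [e, e1, e2, abs_mul, abs_of_pos hr, abs_mul, mul_comm, mul_div_assoc', mul_comm (9 : ℝ),
    mul_div_assoc]
  refine mul_le_mul_of_nonneg_left ?_ hr.le
  rw [abs_of_pos (by positivity : 0 < 1 / (2 * (n : ℝ) + 1)), abs_div,
    abs_of_pos (by linarith : 0 < parB D + n), div_mul_div_comm, one_mul,
    div_le_div_iff₀ (by nlinarith) (by positivity)]
  have h3 : |parB D| ≤ 3 / 2 := abs_le.2 ⟨by linarith, by linarith⟩
  -- From `b > -1/2` and `n - 1/2 ≥ (n+2)/6`, sharp at `n = 1`. The constant `9` is this `6` times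
  -- the bound `3/2` on `|b|`.
  have h4 : ((n : ℝ) + 2) / 6 ≤ parB D + n := by linarith
  calc |parB D| * ((n + 1) * (n + 2)) ≤ 3 / 2 * ((n + 1) * (n + 2)) := by gcongr
    _ ≤ 9 * ((2 * n + 1) * ((n + 2) / 6)) := by nlinarith
    _ ≤ 9 * ((2 * n + 1) * (parB D + n)) := by gcongr

/-- The `(n, k)` term of the double series. -/
noncomputable def doubleTerm (D m X : ℝ) (n k : ℕ) : ℝ :=
  poch (parA D m) (n + 2 * k) * poch (1 / 2) n * poch (parB D) n /
    (poch (3 / 2) (n + k) * poch (parB D + 1) (n + k) * n.factorial) * (-X / 4) ^ k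

/-- Symbols `(x)_n (x+n)_k` merge into `(x)_(n+k)`, and the two half-integer spaced upper parameters
combine by duplication into `(a+n)_(2k) / 4^k`. -/
theorem coeffB_mul_hyp32Term {D m : ℝ} (X : ℝ) (n k : ℕ) :
    coeffB D m n * hyp32Term 1 ((parA D m + n) / 2) ((parA D m + n + 1) / 2)
      (3 / 2 + n) (parB D + 1 + n) (-X) k = doubleTerm D m X n k := by
  have hk : (k.factorial : ℝ) ≠ 0 := by positivity
  rw [doubleTerm, poch_add _ n (2 * k), poch_two_mul, poch_add _ n k, poch_add _ n k, coeffB,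
    hyp32Term, poch_one, div_pow]
  have h4 : (4 : ℝ) ^ k ≠ 0 := by positivity
  rw [div_mul_eq_mul_div, div_mul_div_comm, div_mul_eq_mul_div, mul_div_assoc', div_div]
  rw [← mul_div_mul_left _ _ h4]
  conv_rhs => rw [← mul_div_mul_left _ _ hk]
  congr 1 <;> ring

/-! ### Absolute convergence of the double series -/

section Summability

variable {D m : ℝ}

theorem abs_hyp32Term_param_le (hD4 : D < 4) (hm : 0 < m) (ha : 0 < parA D m)
    (ha2 : parA D m < 2) {X : ℝ} (hX : 0 ≤ X) (n k : ℕ) :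
    |hyp32Term 1 ((parA D m + n) / 2) ((parA D m + n + 1) / 2)
      (3 / 2 + n) (parB D + 1 + n) (-X) k| ≤ X ^ k := by
  have hb : -(1 / 2) < parB D := by unfold parB; linarith
  have hn : (0 : ℝ) ≤ n := n.cast_nonneg
  -- Equivalent to `m ≥ 0`. It bounds `(a+n+1)/2` by `b+1+n`, while `a < 2` bounds `(a+n)/2` by
  -- `3/2+n`.
  have hab : parA D m ≤ 2 * parB D + 1 := by unfold parA parB; linarith
  exact abs_hyp32Term_le (by positivity) (by positivity) (by positivity) (by linarith)
    (by linarith) (by linarith) hX k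

theorem summable_hyp32Term_param (hD4 : D < 4) (hm : 0 < m) (ha : 0 < parA D m)
    (ha2 : parA D m < 2) {X : ℝ} (hX : 0 ≤ X) (hX1 : X < 1) (n : ℕ) :
    Summable (hyp32Term 1 ((parA D m + n) / 2) ((parA D m + n + 1) / 2)
      (3 / 2 + n) (parB D + 1 + n) (-X)) :=
  Summable.of_norm_bounded (summable_geometric_of_lt_one hX hX1)
    (fun k => abs_hyp32Term_param_le hD4 hm ha ha2 hX n k)

theorem summable_abs_doubleTerm (hD : 0 < D) (hD4 : D < 4) (hm : 0 < m) (ha : 0 < parA D m)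
    (ha2 : parA D m < 2) {X : ℝ} (hX : 0 ≤ X) (hX1 : X < 1) :
    Summable fun z : ℕ × ℕ => |doubleTerm D m X z.1 z.2| := by
  refine Summable.of_nonneg_of_le (fun _ => abs_nonneg _) (fun z => ?_)
    ((summable_abs_coeffB hD hD4 ha ha2).mul_of_nonneg (summable_geometric_of_lt_one hX hX1)
      (fun _ => abs_nonneg _) (fun _ => by positivity))
  rw [← coeffB_mul_hyp32Term, abs_mul]
  exact mul_le_mul_of_nonneg_left (abs_hyp32Term_param_le hD4 hm ha ha2 hX _ _) (abs_nonneg _)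

theorem hasSum_doubleTerm (hD : 0 < D) (hD4 : D < 4) (hm : 0 < m) (ha : 0 < parA D m)
    (ha2 : parA D m < 2) {X : ℝ} (hX : 0 ≤ X) (hX1 : X < 1) :
    HasSum (fun n : ℕ => coeffB D m n *
        hyp32 1 ((parA D m + n) / 2) ((parA D m + n + 1) / 2)
          (3 / 2 + n) (parB D + 1 + n) (-X)) (∑' z : ℕ × ℕ, doubleTerm D m X z.1 z.2) := by
  have hs := (summable_abs_doubleTerm hD hD4 hm ha ha2 hX hX1).of_abs
  refine hs.hasSum.prod_fiberwise (fun n => ?_)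
  simp only [← coeffB_mul_hyp32Term]
  exact (summable_hyp32Term_param hD4 hm ha ha2 hX hX1 n).hasSum.mul_left _

end Summability

/-! ### Integral formulas -/

/-- All integrands here are nonnegative up to a constant, so values are computed as lower Lebesgue
integrals, where Tonelli needs only measurability. A finite value then gives integrability and the
Bochner integral together. -/
theorem integrable_and_integral_eq_of_lintegral {Ω : Type*} [MeasurableSpace Ω] {ν : Measure Ω}
    {f : Ω → ℝ} {c : ℝ} (hf : AEStronglyMeasurable f ν) (h0 : 0 ≤ᵐ[ν] f) (hc : 0 ≤ c)
    (h : ∫⁻ x, ENNReal.ofReal (f x) ∂ν = ENNReal.ofReal c) :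
    Integrable f ν ∧ ∫ x, f x ∂ν = c := by
  constructor
  · refine ⟨hf, ?_⟩
    rw [hasFiniteIntegral_iff_ofReal h0, h]
    exact ENNReal.ofReal_lt_top
  · rw [integral_eq_lintegral_of_nonneg_ae h0 hf, h, ENNReal.toReal_ofReal hc]

theorem lintegral_gamma_kernel {N x : ℝ} (hN : 0 < N) (hx : 0 < x) :
    ∫⁻ t in Ioi (0 : ℝ), ENNReal.ofReal (t ^ (N - 1) * Real.exp (-(t * x))) =
      ENNReal.ofReal (Real.Gamma N * x ^ (-N)) := by
  have h1 : IntegrableOn (fun t : ℝ => t ^ (N - 1) * Real.exp (-(t * x))) (Ioi 0) := by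
    have := integrableOn_rpow_mul_exp_neg_mul_rpow (p := 1) (s := N - 1) (b := x) (by linarith)
      one_pos hx
    refine this.congr_fun (fun t _ => ?_) measurableSet_Ioi
    simp [mul_comm]
  have h2 := Real.integral_rpow_mul_exp_neg_mul_Ioi hN hx
  rw [← ofReal_integral_eq_lintegral_ofReal h1]
  · congr 1
    rw [one_div, Real.inv_rpow hx.le, ← Real.rpow_neg hx.le, mul_comm] at h2
    rw [← h2]
    simp only [mul_comm]
  · filter_upwards [ae_restrict_mem measurableSet_Ioi] with t ht
    have : (0 : ℝ) < t := ht
    positivity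

/-- If the moments `∫ g exp(-τ h)` are `K τ^(-α)`, then `∫ g (h + C)^(-N)` follows by writing the
power as a Gamma integral. -/
theorem lintegral_mul_add_rpow_of_moment {Ω : Type*} [MeasurableSpace Ω] {ν : Measure Ω}
    [SFinite ν] {g h : Ω → ℝ} (hg : Measurable g) (hh : Measurable h)
    (hg0 : ∀ᵐ x ∂ν, 0 ≤ g x) (hh0 : ∀ᵐ x ∂ν, 0 ≤ h x) {K α N C : ℝ} (hK : 0 ≤ K) (hN : 0 < N)
    (hα : α < N) (hC : 0 < C)
    (hmom : ∀ t : ℝ, 0 < t →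
      ∫⁻ x, ENNReal.ofReal (g x * Real.exp (-(t * h x))) ∂ν = ENNReal.ofReal (K * t ^ (-α))) :
    ∫⁻ x, ENNReal.ofReal (g x * (h x + C) ^ (-N)) ∂ν =
      ENNReal.ofReal (K * (Real.Gamma (N - α) / Real.Gamma N) * C ^ (α - N)) := by
  have hΓ : 0 < Real.Gamma N := Real.Gamma_pos_of_pos hN
  have key : ENNReal.ofReal (Real.Gamma N) * ∫⁻ x, ENNReal.ofReal (g x * (h x + C) ^ (-N)) ∂ν =
      ENNReal.ofReal (K * Real.Gamma (N - α) * C ^ (α - N)) := by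
    rw [← lintegral_const_mul _ (by fun_prop)]
    calc ∫⁻ x, ENNReal.ofReal (Real.Gamma N) * ENNReal.ofReal (g x * (h x + C) ^ (-N)) ∂ν
        = ∫⁻ x, (∫⁻ t in Ioi (0 : ℝ),
            ENNReal.ofReal (g x * (t ^ (N - 1) * Real.exp (-(t * (h x + C)))))) ∂ν := by
          refine lintegral_congr_ae ?_
          filter_upwards [hg0, hh0] with x hgx hhx
          simp only [ENNReal.ofReal_mul hgx]
          rw [lintegral_const_mul _ (by fun_prop), lintegral_gamma_kernel hN (by linarith),
            ENNReal.ofReal_mul hΓ.le]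
          ring
      _ = ∫⁻ t in Ioi (0 : ℝ), ∫⁻ x,
            ENNReal.ofReal (g x * (t ^ (N - 1) * Real.exp (-(t * (h x + C))))) ∂ν := by
          refine lintegral_lintegral_swap ?_
          refine Measurable.aemeasurable ?_
          fun_prop
      _ = ∫⁻ t in Ioi (0 : ℝ), ENNReal.ofReal K *
            ENNReal.ofReal (t ^ (N - α - 1) * Real.exp (-(t * C))) := by
          refine setLIntegral_congr_fun measurableSet_Ioi (fun t ht => ?_)
          have ht : (0 : ℝ) < t := ht
          have e : ∀ x, ENNReal.ofReal (g x * (t ^ (N - 1) * Real.exp (-(t * (h x + C))))) =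
              ENNReal.ofReal (t ^ (N - 1) * Real.exp (-(t * C))) *
                ENNReal.ofReal (g x * Real.exp (-(t * h x))) := by
            intro x
            rw [← ENNReal.ofReal_mul (by positivity)]
            congr 1
            rw [mul_add, neg_add, Real.exp_add]; ring
          simp only [e]
          rw [lintegral_const_mul _ (by fun_prop), hmom t ht, ← ENNReal.ofReal_mul (by positivity),
            ← ENNReal.ofReal_mul hK]
          congr 1
          rw [show N - α - 1 = (N - 1) + -α by ring, Real.rpow_add ht]; ring
      _ = _ := by
          rw [lintegral_const_mul _ (by fun_prop), lintegral_gamma_kernel (by linarith) hC,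
            ← ENNReal.ofReal_mul hK]
          congr 1
          rw [neg_sub]; ring
  have h0 : ENNReal.ofReal (Real.Gamma N) ≠ 0 := by simpa using hΓ
  rw [← ENNReal.mul_right_inj h0 ENNReal.ofReal_ne_top, key, ← ENNReal.ofReal_mul hΓ.le]
  congr 1
  field_simp

/-- Beta integral over the half-line. -/
theorem lintegral_rpow_mul_add_rpow {s N C : ℝ} (hs : 0 < s) (hN : s < N) (hC : 0 < C) :
    ∫⁻ u in Ioi (0 : ℝ), ENNReal.ofReal (u ^ (s - 1) * (u + C) ^ (-N)) =
      ENNReal.ofReal (Real.Gamma s * (Real.Gamma (N - s) / Real.Gamma N) * C ^ (s - N)) := by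
  refine lintegral_mul_add_rpow_of_moment (g := fun u : ℝ => u ^ (s - 1)) (h := fun u => u)
    (by fun_prop) measurable_id ?_ ?_ (Real.Gamma_pos_of_pos hs).le (hs.trans hN) hN hC ?_
  · filter_upwards [ae_restrict_mem measurableSet_Ioi] with t ht
    exact Real.rpow_nonneg (le_of_lt ht) _
  · filter_upwards [ae_restrict_mem measurableSet_Ioi] with t ht
    exact le_of_lt ht
  · intro t ht
    rw [← lintegral_gamma_kernel hs ht]
    simp only [mul_comm t]

theorem integrable_and_integral_pow_mul_exp_neg_sq (n : ℕ) {t : ℝ} (ht : 0 < t) :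
    Integrable (fun y : ℝ => y ^ (2 * n) * Real.exp (-(t * y ^ 2))) ∧
    ∫ y : ℝ, y ^ (2 * n) * Real.exp (-(t * y ^ 2)) =
      Real.Gamma (n + 1 / 2) * t ^ (-((n : ℝ) + 1 / 2)) := by
  have hn : (-1 : ℝ) < ((2 * n : ℕ) : ℝ) := by
    have : (0 : ℝ) ≤ ((2 * n : ℕ) : ℝ) := Nat.cast_nonneg _
    linarith
  constructor
  · have := integrable_rpow_mul_exp_neg_mul_sq ht hn
    simpa only [Real.rpow_natCast, neg_mul] using this
  · have h1 := integral_comp_abs (f := fun y : ℝ => y ^ (2 * n) * Real.exp (-(t * y ^ 2)))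
    simp only [sq_abs, pow_mul] at h1
    simp only [pow_mul]
    rw [h1]
    have h2 := integral_rpow_mul_exp_neg_mul_rpow (p := 2) two_pos hn ht
    have h3 : ∫ x in Ioi (0 : ℝ), (x ^ 2) ^ n * Real.exp (-(t * x ^ 2)) =
        ∫ x in Ioi (0 : ℝ), x ^ ((2 * n : ℕ) : ℝ) * Real.exp (-t * x ^ (2 : ℝ)) := by
      congr 1; ext x
      rw [Real.rpow_natCast, pow_mul, Real.rpow_two, neg_mul]
    rw [h3, h2]
    push_cast
    rw [show (2 * (n : ℝ) + 1) / 2 = n + 1 / 2 by ring,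
      show -(2 * (n : ℝ) + 1) / 2 = -(n + 1 / 2) by ring]
    ring

theorem lintegral_pow_mul_sq_add_rpow (n : ℕ) {N C : ℝ} (hN : n + 1 / 2 < N) (hC : 0 < C) :
    ∫⁻ y : ℝ, ENNReal.ofReal (y ^ (2 * n) * (y ^ 2 + C) ^ (-N)) =
      ENNReal.ofReal (Real.Gamma (n + 1 / 2) *
        (Real.Gamma (N - (n + 1 / 2)) / Real.Gamma N) * C ^ ((n + 1 / 2) - N)) := by
  have hn : (0 : ℝ) < n + 1 / 2 := by positivity
  refine lintegral_mul_add_rpow_of_moment (g := fun y : ℝ => y ^ (2 * n)) (h := fun y => y ^ 2)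
    (by fun_prop) (by fun_prop) (ae_of_all _ fun y => ?_) (ae_of_all _ fun y => sq_nonneg y)
    (Real.Gamma_pos_of_pos hn).le (hn.trans hN) hN hC ?_
  · exact (even_two_mul n).pow_nonneg y
  · intro t ht
    obtain ⟨h1, h2⟩ := integrable_and_integral_pow_mul_exp_neg_sq n ht
    rw [← h2, ofReal_integral_eq_lintegral_ofReal h1]
    exact ae_of_all _ fun y => mul_nonneg ((even_two_mul n).pow_nonneg y) (Real.exp_nonneg _)

/-! ### A quadratic transformation: spherical means of powers -/

/-- The squared distance kernel `(1 - z)² + 4 s z`. -/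
noncomputable def meanKernel (s : ℝ) (z : ℂ) : ℂ := 1 + 2 * (2 * s - 1) * z + z ^ 2

/-- Weighted mean of a power of `meanKernel`. -/
noncomputable def meanPow (k : ℕ) (μ z : ℂ) : ℂ :=
  ∫ s in (0 : ℝ)..1, ((s * (1 - s)) ^ k : ℂ) * meanKernel s z ^ (-μ)

theorem meanKernel_mem_slitPlane {s : ℝ} (hs : s ∈ Icc (0 : ℝ) 1) {z : ℂ}
    (hz : z ∈ Metric.ball (0 : ℂ) 1) : meanKernel s z ∈ Complex.slitPlane := by
  obtain ⟨x, y⟩ := z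
  have hz' : x ^ 2 + y ^ 2 < 1 := by
    rw [mem_ball_zero_iff, ← sq_lt_one_iff₀ (norm_nonneg _), Complex.sq_norm,
      Complex.normSq_apply] at hz
    simp only at hz
    nlinarith
  have hre : (meanKernel s ⟨x, y⟩).re = 1 + 2 * (2 * s - 1) * x + (x ^ 2 - y ^ 2) := by
    simp [meanKernel, pow_two]
  have him : (meanKernel s ⟨x, y⟩).im = 2 * y * ((2 * s - 1) + x) := by
    simp [meanKernel, pow_two]; ring
  rw [Complex.mem_slitPlane_iff, hre, him]
  by_contra! h
  obtain ⟨h1, h2⟩ := h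
  obtain ⟨hs0, hs1⟩ := hs
  -- Where the imaginary part vanishes the kernel is positive: for `y = 0` it is `s(1+x)² +
  -- (1-s)(1-x)²`, and for `x = 1 - 2s` its real part is `1 - x² - y²`.
  rcases mul_eq_zero.1 h2 with h3 | h3
  · have hy : y = 0 := by linarith
    subst hy
    have hx1 : x < 1 := by nlinarith
    have hx2 : -1 < x := by nlinarith
    nlinarith [mul_nonneg hs0 (sub_nonneg.2 hs1), mul_pos (by linarith : 0 < 1 - x)
      (by linarith : 0 < 1 - x), mul_pos (by linarith : 0 < 1 + x) (by linarith : 0 < 1 + x),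
      mul_nonneg hs0 (mul_pos (by linarith : 0 < 1 + x) (by linarith : 0 < 1 + x)).le,
      mul_nonneg (sub_nonneg.2 hs1) (mul_pos (by linarith : 0 < 1 - x)
      (by linarith : 0 < 1 - x)).le]
  · have hx : x = -(2 * s - 1) := by linarith
    subst hx
    nlinarith

theorem continuousOn_meanKernel_cpow (ν : ℂ) :
    ContinuousOn (fun q : ℝ × ℂ => meanKernel q.1 q.2 ^ ν)
      (Icc (0 : ℝ) 1 ×ˢ Metric.ball (0 : ℂ) 1) := by
  refine ContinuousOn.cpow_const ?_ (fun q hq => meanKernel_mem_slitPlane hq.1 hq.2)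
  unfold meanKernel
  fun_prop

theorem continuousOn_meanKernel_cpow_left (ν : ℂ) {z : ℂ} (hz : z ∈ Metric.ball (0 : ℂ) 1) :
    ContinuousOn (fun s : ℝ => meanKernel s z ^ ν) (Icc (0 : ℝ) 1) := by
  refine (continuousOn_meanKernel_cpow ν).comp (f := fun s : ℝ => (s, z)) (by fun_prop) ?_
  exact fun s hs => ⟨hs, hz⟩

theorem hasDerivAt_meanPow_aux (k : ℕ) (μ : ℂ) {z : ℂ} (hz : z ∈ Metric.ball (0 : ℂ) 1) :
    HasDerivAt (meanPow k μ) (∫ s in (0 : ℝ)..1, ((s * (1 - s)) ^ k : ℂ) *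
      (-μ * meanKernel s z ^ (-μ - 1) * (2 * (2 * s - 1) + 2 * z))) z := by
  obtain ⟨r, hr1, hr2⟩ : ∃ r > 0, Metric.closedBall z r ⊆ Metric.ball (0 : ℂ) 1 :=
    Metric.nhds_basis_closedBall.mem_iff.1 (Metric.isOpen_ball.mem_nhds hz)
  set F' : ℂ → ℝ → ℂ := fun z s => ((s * (1 - s)) ^ k : ℂ) *
      (-μ * meanKernel s z ^ (-μ - 1) * (2 * (2 * s - 1) + 2 * z)) with hF'
  have hsub : uIoc (0 : ℝ) 1 ⊆ Icc 0 1 := by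
    rw [uIoc_of_le zero_le_one]; exact Ioc_subset_Icc_self
  have hcont : ContinuousOn (fun q : ℝ × ℂ => F' q.2 q.1)
      (Icc (0 : ℝ) 1 ×ˢ Metric.ball (0 : ℂ) 1) := by
    have := continuousOn_meanKernel_cpow (-μ - 1)
    simp only [hF']
    refine ContinuousOn.mul (by fun_prop) (ContinuousOn.mul (ContinuousOn.mul (by fun_prop) this)
      (by fun_prop))
  have hcompact : IsCompact (Icc (0 : ℝ) 1 ×ˢ Metric.closedBall z r) :=
    isCompact_Icc.prod (isCompact_closedBall _ _)
  obtain ⟨M, hM⟩ := hcompact.exists_bound_of_continuousOn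
    (hcont.mono (prod_mono_right hr2))
  have hF : ∀ x ∈ Metric.ball (0 : ℂ) 1, ContinuousOn
      (fun s : ℝ => ((s * (1 - s)) ^ k : ℂ) * meanKernel s x ^ (-μ)) (Icc 0 1) := fun x hx =>
    ContinuousOn.mul (by fun_prop) (continuousOn_meanKernel_cpow_left _ hx)
  refine (intervalIntegral.hasDerivAt_integral_of_dominated_loc_of_deriv_le (μ := volume)
    (F := fun (z : ℂ) (s : ℝ) => ((s * (1 - s)) ^ k : ℂ) * meanKernel s z ^ (-μ)) (F' := F')
    (s := Metric.closedBall z r) (bound := fun _ => M)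
    (Metric.closedBall_mem_nhds z hr1) ?_ ?_ ?_ ?_ ?_ ?_).2
  · filter_upwards [Metric.isOpen_ball.mem_nhds hz] with x hx
    exact ((hF x hx).mono hsub).aestronglyMeasurable measurableSet_uIoc
  · refine ContinuousOn.intervalIntegrable ?_
    rw [uIcc_of_le zero_le_one]; exact hF z hz
  · refine ContinuousOn.aestronglyMeasurable ?_ measurableSet_uIoc
    exact hcont.comp (f := fun s : ℝ => (s, z)) (by fun_prop) (fun s hs => ⟨hsub hs, hz⟩)
  · exact ae_of_all _ fun s hs x hx => hM (s, x) ⟨hsub hs, hx⟩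
  · exact intervalIntegrable_const
  · refine ae_of_all _ fun s hs x hx => ?_
    have h1 : HasDerivAt (meanKernel s) (2 * (2 * s - 1) + 2 * x) x := by
      have := (((hasDerivAt_id x).const_mul (2 * (2 * (s : ℂ) - 1))).const_add 1).add
        ((hasDerivAt_id x).pow 2)
      convert! this using 1
      simp
    exact (h1.cpow_const (meanKernel_mem_slitPlane (hsub hs) (hr2 hx))).const_mul _

/-- Integrate the `s`-derivative of `(s(1-s))^(k+1)` times the power `-ν` of the kernel. The
boundary terms vanish, and the kernel has `s`-derivative `4z`, which is the source of the factor
`z`. -/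
theorem integral_meanKernel_by_parts (k : ℕ) (ν : ℂ) {z : ℂ} (hz : z ∈ Metric.ball (0 : ℂ) 1) :
    (k + 1) * ∫ s in (0 : ℝ)..1, ((s * (1 - s)) ^ k : ℂ) * ((2 * s - 1) * meanKernel s z ^ (-ν)) =
      -(4 * ν * z) * meanPow (k + 1) (ν + 1) z := by
  set f1 : ℝ → ℂ := fun s => ((s * (1 - s)) ^ k : ℂ) * ((2 * s - 1) * meanKernel s z ^ (-ν))
  set f2 : ℝ → ℂ := fun s => ((s * (1 - s)) ^ (k + 1) : ℂ) * meanKernel s z ^ (-(ν + 1))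
  have c1 : ContinuousOn f1 (Icc 0 1) := ContinuousOn.mul (by fun_prop)
    (ContinuousOn.mul (by fun_prop) (continuousOn_meanKernel_cpow_left _ hz))
  have c2 : ContinuousOn f2 (Icc 0 1) := ContinuousOn.mul (by fun_prop)
    (continuousOn_meanKernel_cpow_left _ hz)
  have i1 : IntervalIntegrable f1 volume 0 1 := by
    refine ContinuousOn.intervalIntegrable ?_
    rwa [uIcc_of_le zero_le_one]
  have i2 : IntervalIntegrable f2 volume 0 1 := by
    refine ContinuousOn.intervalIntegrable ?_
    rwa [uIcc_of_le zero_le_one]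
  have hd : ∀ s ∈ uIcc (0 : ℝ) 1, HasDerivAt
      (fun s : ℝ => ((s * (1 - s)) ^ (k + 1) : ℂ) * meanKernel s z ^ (-ν))
      (-(k + 1) * f1 s + -(4 * ν * z) * f2 s) s := by
    intro s hs
    rw [uIcc_of_le zero_le_one] at hs
    have h0 : HasDerivAt (fun s : ℝ => (s : ℂ)) 1 s := Complex.ofRealCLM.hasDerivAt
    have h1 : HasDerivAt (fun s : ℝ => meanKernel s z) (4 * z) s := by
      have := ((((h0.const_mul 2).sub_const 1).const_mul 2).mul_const z).const_add 1
        |>.add_const (z ^ 2)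
      convert! this using 1
      ring
    have h3 : HasDerivAt (fun w : ℂ => w ^ (-ν)) (-ν * meanKernel s z ^ (-ν - 1) * 1)
        (meanKernel s z) :=
      (hasDerivAt_id _).cpow_const (meanKernel_mem_slitPlane hs hz)
    have h2 := ((h0.mul (h0.const_sub 1)).pow (k + 1)).mul (h3.comp s h1)
    convert! h2 using 1
    simp only [f1, f2, Function.comp_apply, Pi.mul_apply, Pi.pow_apply, Nat.add_sub_cancel, neg_add']
    push_cast
    ring
  have := intervalIntegral.integral_eq_sub_of_hasDerivAt hd
    ((i1.const_mul _).add (i2.const_mul _))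
  rw [intervalIntegral.integral_add (i1.const_mul _) (i2.const_mul _),
    intervalIntegral.integral_const_mul, intervalIntegral.integral_const_mul] at this
  simp only [Complex.ofReal_zero, Complex.ofReal_one, zero_mul, sub_self, mul_zero,
    zero_pow (Nat.succ_ne_zero k), sub_zero] at this
  rw [meanPow]
  linear_combination -this

/-- Differentiation under the integral produces a part with `2s - 1` and a part with `z`.
Integration by parts puts a factor `z` in front of the first as well, so the family of means is
closed under `z⁻¹ d/dz`. This determines all Taylor coefficients at `0` recursively and shows that
the odd ones vanish. -/
theorem hasDerivAt_meanPow (k : ℕ) (μ : ℂ) {z : ℂ} (hz : z ∈ Metric.ball (0 : ℂ) 1) :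
    HasDerivAt (meanPow k μ) (z * (-2 * μ * meanPow k (μ + 1) z +
      8 * μ * (μ + 1) / (k + 1) * meanPow (k + 1) (μ + 2) z)) z := by
  convert hasDerivAt_meanPow_aux k μ hz using 1
  have hk : (k : ℂ) + 1 ≠ 0 := by exact_mod_cast Nat.succ_ne_zero k
  have h1 := integral_meanKernel_by_parts k (μ + 1) hz
  rw [show μ + 1 + 1 = μ + 2 by ring] at h1
  have i1 : IntervalIntegrable (fun s : ℝ => ((s * (1 - s)) ^ k : ℂ) *
      ((2 * s - 1) * meanKernel s z ^ (-(μ + 1)))) volume 0 1 := by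
    refine ContinuousOn.intervalIntegrable ?_
    rw [uIcc_of_le zero_le_one]
    exact ContinuousOn.mul (by fun_prop)
      (ContinuousOn.mul (by fun_prop) (continuousOn_meanKernel_cpow_left _ hz))
  have i2 : IntervalIntegrable (fun s : ℝ => ((s * (1 - s)) ^ k : ℂ) *
      meanKernel s z ^ (-(μ + 1))) volume 0 1 := by
    refine ContinuousOn.intervalIntegrable ?_
    rw [uIcc_of_le zero_le_one]
    exact ContinuousOn.mul (by fun_prop) (continuousOn_meanKernel_cpow_left _ hz)
  have e : ∀ s : ℝ, ((s * (1 - s)) ^ k : ℂ) *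
      (-μ * meanKernel s z ^ (-μ - 1) * (2 * (2 * s - 1) + 2 * z)) =
      -2 * μ * (((s * (1 - s)) ^ k : ℂ) * ((2 * s - 1) * meanKernel s z ^ (-(μ + 1)))) +
      -2 * μ * z * (((s * (1 - s)) ^ k : ℂ) * meanKernel s z ^ (-(μ + 1))) := by
    intro s; rw [neg_add' μ 1]; ring
  simp only [e]
  rw [intervalIntegral.integral_add (i1.const_mul _) (i2.const_mul _),
    intervalIntegral.integral_const_mul, intervalIntegral.integral_const_mul]
  change _ = _ + -2 * μ * z * meanPow k (μ + 1) z
  have h2 : ∫ s in (0 : ℝ)..1, ((s * (1 - s)) ^ k : ℂ) *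
      ((2 * s - 1) * meanKernel s z ^ (-(μ + 1))) =
      -(4 * (μ + 1) * z) * meanPow (k + 1) (μ + 2) z / (k + 1) := by
    rw [eq_div_iff hk, ← h1]; ring
  rw [h2]
  field_simp
  ring

theorem differentiableOn_meanPow (k : ℕ) (μ : ℂ) :
    DifferentiableOn ℂ (meanPow k μ) (Metric.ball 0 1) := fun _ hz =>
  (hasDerivAt_meanPow k μ hz).differentiableAt.differentiableWithinAt

theorem meanPow_zero_arg (k : ℕ) (μ : ℂ) :
    meanPow k μ 0 = (k.factorial : ℂ) ^ 2 / ((2 * k + 1).factorial : ℂ) := by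
  have h : meanPow k μ 0 = Complex.betaIntegral (k + 1) (k + 1) := by
    rw [meanPow, Complex.betaIntegral]
    congr 1; ext s
    simp [meanKernel, mul_pow]
  have hk : 0 < ((k : ℂ) + 1).re := by
    simp only [Complex.add_re, Complex.natCast_re, Complex.one_re]; positivity
  rw [h, Complex.betaIntegral_eq_Gamma_mul_div _ _ hk hk, Complex.Gamma_nat_eq_factorial,
    show (k : ℂ) + 1 + (k + 1) = ((2 * k + 1 : ℕ) : ℂ) + 1 by push_cast; ring,
    Complex.Gamma_nat_eq_factorial, pow_two]

theorem contDiffAt_meanPow (k : ℕ) (μ : ℂ) (n : WithTop ℕ∞) : ContDiffAt ℂ n (meanPow k μ) 0 :=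
  ((differentiableOn_meanPow k μ).analyticAt (Metric.ball_mem_nhds _ one_pos)).contDiffAt

theorem deriv_meanPow_eventuallyEq (k : ℕ) (μ : ℂ) :
    deriv (meanPow k μ) =ᶠ[𝓝 0] (fun z => z) * fun z => (-2 * μ * meanPow k (μ + 1) z +
      8 * μ * (μ + 1) / (k + 1) * meanPow (k + 1) (μ + 2) z) := by
  filter_upwards [Metric.ball_mem_nhds (0 : ℂ) one_pos] with z hz
  exact (hasDerivAt_meanPow k μ hz).deriv

theorem iteratedDeriv_one_meanPow (k : ℕ) (μ : ℂ) : iteratedDeriv 1 (meanPow k μ) 0 = 0 := by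
  rw [iteratedDeriv_one, (hasDerivAt_meanPow k μ (Metric.mem_ball_self one_pos)).deriv, zero_mul]

theorem iteratedDeriv_add_two_meanPow (k : ℕ) (μ : ℂ) (n : ℕ) :
    iteratedDeriv (n + 2) (meanPow k μ) 0 =
      (n + 1) * (-2 * μ * iteratedDeriv n (meanPow k (μ + 1)) 0 +
        8 * μ * (μ + 1) / (k + 1) * iteratedDeriv n (meanPow (k + 1) (μ + 2)) 0) := by
  have h1 : ContDiffAt ℂ ((n + 1 : ℕ) : WithTop ℕ∞)
      (fun z => -2 * μ * meanPow k (μ + 1) z) 0 := contDiffAt_const.mul (contDiffAt_meanPow _ _ _)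
  have h2 : ContDiffAt ℂ ((n + 1 : ℕ) : WithTop ℕ∞)
      (fun z => 8 * μ * (μ + 1) / (k + 1) * meanPow (k + 1) (μ + 2) z) 0 :=
    contDiffAt_const.mul (contDiffAt_meanPow _ _ _)
  rw [iteratedDeriv_succ', (deriv_meanPow_eventuallyEq k μ).iteratedDeriv_eq,
    iteratedDeriv_mul (f := fun z : ℂ => z) contDiffAt_id (h1.add h2)]
  -- In the Leibniz formula for `z · G` at `0` only the first derivative of `z` survives.
  rw [Finset.sum_eq_single 1]
  · simp only [iteratedDeriv_fun_id_zero, Nat.add_sub_cancel, Nat.choose_one_right]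
    have e : iteratedDeriv n (fun z => -2 * μ * meanPow k (μ + 1) z +
        8 * μ * (μ + 1) / (k + 1) * meanPow (k + 1) (μ + 2) z) 0 =
        -2 * μ * iteratedDeriv n (meanPow k (μ + 1)) 0 +
        8 * μ * (μ + 1) / (k + 1) * iteratedDeriv n (meanPow (k + 1) (μ + 2)) 0 := by
      rw [iteratedDeriv_fun_add (contDiffAt_const.mul (contDiffAt_meanPow _ _ _))
        (contDiffAt_const.mul (contDiffAt_meanPow _ _ _)),
        iteratedDeriv_const_mul _ (contDiffAt_meanPow _ _ _),
        iteratedDeriv_const_mul _ (contDiffAt_meanPow _ _ _)]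
    rw [e]; push_cast; ring
  · intro i _ hi
    rw [iteratedDeriv_fun_id_zero, if_neg hi]; ring
  · intro h
    exact absurd (Finset.mem_range.2 (by omega)) h

/-- Taylor coefficient of `meanPow`. -/
noncomputable def meanCoeff (k : ℕ) (μ : ℝ) (n : ℕ) : ℝ :=
  (k.factorial : ℝ) ^ 2 / (2 * k + 1).factorial *
    (poch μ n * poch (μ - k - 1 / 2) n / (poch (k + 3 / 2) n * n.factorial))

/-- The recursion that `hasDerivAt_meanPow` imposes on the coefficients of `z^(2n)`, with the common
factor `2` removed. -/
theorem meanCoeff_succ (k : ℕ) (μ : ℝ) (n : ℕ) :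
    (n + 1) * meanCoeff k μ (n + 1) = -μ * meanCoeff k (μ + 1) n +
      4 * μ * (μ + 1) / (k + 1) * meanCoeff (k + 1) (μ + 2) n := by
  have hc : (0 : ℝ) < k + 3 / 2 := by positivity
  have h1 : poch μ (n + 1) = μ * poch (μ + 1) n := poch_succ_left _ _
  have h2 : poch (μ + 1) n * (μ + 1 + n) = (μ + 1) * poch (μ + 2) n := by
    rw [poch_mul_add, show μ + 1 + 1 = μ + 2 by ring]
  have h3 : poch ((k : ℝ) + 3 / 2) (n + 1) = (k + 3 / 2) * poch (k + 3 / 2 + 1) n :=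
    poch_succ_left _ _
  have h3' := poch_mul_add ((k : ℝ) + 3 / 2) n
  have h4 : poch (μ - k - 1 / 2) (n + 1) = (μ - k - 1 / 2) * poch (μ - k - 1 / 2 + 1) n :=
    poch_succ_left _ _
  have p1 := poch_pos hc n
  have p2 := poch_pos (add_pos hc one_pos) n
  have p3 : poch ((k : ℝ) + 3 / 2) n = (k + 3 / 2) * poch (k + 3 / 2 + 1) n / (k + 3 / 2 + n) := by
    rw [eq_div_iff (by positivity), h3']
  have h5 : poch (μ + 2) n * (μ + 1) = poch (μ + 1) n * (μ + 1 + n) := by rw [h2]; ring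
  have hf : ((2 * (k + 1) + 1).factorial : ℝ) =
      (2 * k + 3) * (2 * (k + 1)) * (2 * k + 1).factorial := by
    rw [show 2 * (k + 1) + 1 = 2 * k + 1 + 1 + 1 by ring, Nat.factorial_succ, Nat.factorial_succ]
    push_cast; ring
  unfold meanCoeff
  rw [h1, h3, h4, Nat.factorial_succ n, Nat.factorial_succ k, hf, p3]
  push_cast
  rw [show μ + 1 - (k : ℝ) - 1 / 2 = μ - k - 1 / 2 + 1 by ring,
    show μ + 2 - ((k : ℝ) + 1) - 1 / 2 = μ - k - 1 / 2 + 1 by ring,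
    show (k : ℝ) + 1 + 3 / 2 = k + 3 / 2 + 1 by ring]
  generalize poch ((k : ℝ) + 3 / 2 + 1) n = A at *
  generalize poch (μ - k - 1 / 2 + 1) n = B at *
  generalize poch (μ + 1) n = P at *
  generalize poch (μ + 2) n = R at *
  -- Exposes `(μ+1) (μ+2)_n`, so that `h5` replaces it by a multiple of `(μ+1)_n` and a single
  -- `μ`-symbol remains.
  rw [show 4 * μ * (μ + 1) / ((k : ℝ) + 1) * ((((k : ℝ) + 1) * k.factorial) ^ 2 /
      ((2 * k + 3) * (2 * (k + 1)) * (2 * k + 1).factorial) * (R * B / (A * n.factorial))) =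
      4 * μ / ((k : ℝ) + 1) * ((((k : ℝ) + 1) * k.factorial) ^ 2 /
      ((2 * k + 3) * (2 * (k + 1)) * (2 * k + 1).factorial) *
        ((R * (μ + 1)) * B / (A * n.factorial))) by ring, h5]
  have hfk : ((2 * k + 1).factorial : ℝ) ≠ 0 := by positivity
  have hfn : (n.factorial : ℝ) ≠ 0 := by positivity
  field_simp
  ring

theorem iteratedDeriv_meanPow (n : ℕ) : ∀ (k : ℕ) (μ : ℝ),
    iteratedDeriv (2 * n) (meanPow k μ) 0 = (((2 * n).factorial * meanCoeff k μ n : ℝ) : ℂ) ∧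
    iteratedDeriv (2 * n + 1) (meanPow k μ) 0 = 0 := by
  induction n with
  | zero =>
    intro k μ
    refine ⟨?_, iteratedDeriv_one_meanPow k μ⟩
    simp [meanPow_zero_arg, meanCoeff]
  | succ n ih =>
    intro k μ
    have e1 : (μ : ℂ) + 1 = ((μ + 1 : ℝ) : ℂ) := by push_cast; ring
    have e2 : (μ : ℂ) + 2 = ((μ + 2 : ℝ) : ℂ) := by push_cast; ring
    constructor
    · rw [show 2 * (n + 1) = 2 * n + 2 by ring, iteratedDeriv_add_two_meanPow, e1, e2,
        (ih _ _).1, (ih _ _).1]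
      have h := meanCoeff_succ k μ n
      have hc : (((n : ℝ) + 1) * meanCoeff k μ (n + 1) : ℂ) = -μ * meanCoeff k (μ + 1) n +
        4 * μ * (μ + 1) / (k + 1) * meanCoeff (k + 1) (μ + 2) n := by exact_mod_cast h
      rw [Nat.factorial_succ, Nat.factorial_succ]
      push_cast at hc ⊢
      linear_combination (-2 * (2 * n + 1) * ((2 * n).factorial : ℂ)) * hc
    · rw [show 2 * (n + 1) + 1 = 2 * n + 1 + 2 by ring, iteratedDeriv_add_two_meanPow, e1, e2,
        (ih _ _).2, (ih _ _).2]
      simp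

/-- The quadratic transformation of `₂F₁(μ, k + 1; 2k + 2; ·)`, with the left-hand side written as
an Euler integral. -/
theorem hasSum_meanCoeff (k : ℕ) (μ : ℝ) {z : ℝ} (hz : |z| < 1) :
    HasSum (fun n : ℕ => meanCoeff k μ n * z ^ (2 * n))
      (∫ s in (0 : ℝ)..1, (s * (1 - s)) ^ k * (1 + 2 * (2 * s - 1) * z + z ^ 2) ^ (-μ)) := by
  have hz' : (z : ℂ) ∈ Metric.ball (0 : ℂ) 1 := by simpa using hz
  have h1 := Complex.hasSum_taylorSeries_on_ball (differentiableOn_meanPow k μ) hz'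
  have hval : meanPow k μ z =
      ((∫ s in (0 : ℝ)..1, (s * (1 - s)) ^ k * (1 + 2 * (2 * s - 1) * z + z ^ 2) ^ (-μ) : ℝ) : ℂ) := by
    rw [meanPow, ← intervalIntegral.integral_ofReal]
    refine intervalIntegral.integral_congr fun s hs => ?_
    rw [uIcc_of_le zero_le_one] at hs
    have hpos : 0 ≤ 1 + 2 * (2 * s - 1) * z + z ^ 2 := by
      have := abs_lt.1 hz
      nlinarith [mul_nonneg hs.1 (sq_nonneg (1 + z)),
        mul_nonneg (sub_nonneg.2 hs.2) (sq_nonneg (1 - z))]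
    simp only [meanKernel]
    push_cast [Complex.ofReal_cpow hpos]
    rfl
  rw [hval] at h1
  -- The Taylor series is restricted to even indices; its odd coefficients are zero.
  have h2 : Function.Injective (fun n : ℕ => 2 * n) := fun a b h => by simpa using h
  rw [← h2.hasSum_iff] at h1
  · rw [← Complex.hasSum_ofReal]
    convert! h1 using 2 with n
    simp only [Function.comp, sub_zero, (iteratedDeriv_meanPow n k μ).1, smul_eq_mul]
    have : ((2 * n).factorial : ℂ) ≠ 0 := by exact_mod_cast Nat.factorial_ne_zero _
    push_cast
    field_simp
  · intro N hN
    obtain ⟨j, rfl⟩ : ∃ j, N = 2 * j + 1 := by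
      rcases Nat.even_or_odd' N with ⟨j, hj | hj⟩
      · exact absurd ⟨j, hj.symm⟩ hN
      · exact ⟨j, hj⟩
    rw [(iteratedDeriv_meanPow j k μ).2]; simp

/-! ### Expansion of the Feynman-parameter integral -/

theorem hasSum_poch_binomial (l : ℝ) {x : ℝ} (hx : |x| < 1) :
    HasSum (fun k : ℕ => poch l k / k.factorial * (-x) ^ k) ((1 + x) ^ (-l)) := by
  have h := (Real.one_div_one_sub_rpow_hasFPowerSeriesOnBall_zero l).hasSum
    (y := -x) (by simpa [enorm_eq_nnnorm, ← NNReal.coe_lt_coe] using hx)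
  have e : (1 + x) ^ (-l) = 1 / (1 - (0 + -x)) ^ l := by
    rw [Real.rpow_neg (by linarith [(abs_lt.1 hx).1]), one_div]; congr 2; ring
  rw [e]
  convert! h using 2 with k
  have h1 : (k.factorial : ℝ) * Ring.multichoose l k = poch l k := by
    rw [← nsmul_eq_mul, Ring.factorial_nsmul_multichoose_eq_ascPochhammer, poch,
      Polynomial.ascPochhammer_smeval_eq_eval]
  have hk : (k.factorial : ℝ) ≠ 0 := by positivity
  simp only [FormalMultilinearSeries.ofScalars_apply_eq, smul_eq_mul, ← Ring.multichoose_eq]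
  rw [← h1]; field_simp

/-- The difference of the two sides is `(2s - 1 + z)²`. Hence the ratio of `4s(1-s)r` to the kernel
is at most `r`, uniformly in `s`, which dominates the binomial series. -/
theorem mul_one_sub_le_kernel (s z : ℝ) :
    4 * (s * (1 - s)) ≤ 1 + 2 * (2 * s - 1) * z + z ^ 2 := by
  nlinarith [sq_nonneg (2 * s - 1 + z)]

theorem kernel_pos {s : ℝ} (hs : s ∈ Icc (0 : ℝ) 1) {z : ℝ} (hz : |z| < 1) :
    0 < 1 + 2 * (2 * s - 1) * z + z ^ 2 := by
  have h := abs_lt.1 hz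
  have h1 : 0 < (1 - z) ^ 2 := by nlinarith
  have h2 : 0 < (1 + z) ^ 2 := by nlinarith
  rcases hs.1.eq_or_lt with h0 | h0
  · subst h0; nlinarith
  · nlinarith [mul_pos h0 h2, mul_nonneg (sub_nonneg.2 hs.2) h1.le]

theorem hasSum_integral_binomial {l : ℝ} (hl : 0 < l) {r : ℝ} (hr : 0 ≤ r) (hr1 : r < 1) {z : ℝ}
    (hz : |z| < 1) :
    HasSum (fun k : ℕ => poch l k / k.factorial * (-(4 * r)) ^ k *
        ∫ s in (0 : ℝ)..1, (s * (1 - s)) ^ k * (1 + 2 * (2 * s - 1) * z + z ^ 2) ^ (-(l + k)))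
      (∫ s in (0 : ℝ)..1,
        (1 + 2 * (2 * s - 1) * z + z ^ 2 + 4 * (s * (1 - s)) * r) ^ (-l)) := by
  simp_rw [← intervalIntegral.integral_const_mul]
  set w : ℝ → ℝ := fun s => 1 + 2 * (2 * s - 1) * z + z ^ 2 with hw
  have hwc : Continuous w := by fun_prop
  have hsub : uIoc (0 : ℝ) 1 ⊆ Icc 0 1 := by
    rw [uIoc_of_le zero_le_one]; exact Ioc_subset_Icc_self
  have hpow : ∀ ν : ℝ, ContinuousOn (fun s => w s ^ ν) (Icc 0 1) := fun ν =>
    hwc.continuousOn.rpow_const fun s hs => Or.inl (kernel_pos hs hz).ne'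
  have hgeo : HasSum (fun k : ℕ => poch l k / k.factorial * r ^ k) ((1 + -r) ^ (-l)) := by
    have := hasSum_poch_binomial l (x := -r) (by rwa [abs_neg, abs_of_nonneg hr])
    simpa using this
  have hf : ∀ k : ℕ, 0 ≤ poch l k / (k.factorial : ℝ) := fun k =>
    div_nonneg (poch_pos hl k).le (by positivity)
  refine intervalIntegral.hasSum_integral_of_dominated_convergence
    (fun (k : ℕ) s => poch l k / k.factorial * r ^ k * w s ^ (-l)) ?_ ?_ ?_ ?_ ?_
  · intro k
    refine ContinuousOn.aestronglyMeasurable ?_ measurableSet_uIoc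
    exact (ContinuousOn.mul (by fun_prop)
      (ContinuousOn.mul (by fun_prop) (hpow _))).mono hsub
  · intro k
    refine ae_of_all _ fun s hs => ?_
    have hs := hsub hs
    have hws : 0 < w s := kernel_pos hs hz
    have hss : 0 ≤ s * (1 - s) := mul_nonneg hs.1 (sub_nonneg.2 hs.2)
    have h4 := mul_one_sub_le_kernel s z
    rw [Real.norm_eq_abs, abs_mul, abs_mul, abs_of_nonneg (hf k), abs_pow, abs_neg,
      abs_of_nonneg (by positivity : 0 ≤ 4 * r), abs_of_nonneg (by positivity), mul_assoc,
      mul_assoc (poch l k / _)]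
    refine mul_le_mul_of_nonneg_left ?_ (hf k)
    change (4 * r) ^ k * ((s * (1 - s)) ^ k * w s ^ (-(l + k))) ≤ _
    rw [neg_add, ← sub_eq_add_neg, Real.rpow_sub hws, Real.rpow_natCast]
    calc (4 * r) ^ k * ((s * (1 - s)) ^ k * (w s ^ (-l) / w s ^ k))
        = r ^ k * w s ^ (-l) * (4 * (s * (1 - s)) / w s) ^ k := by
          rw [mul_pow, div_pow, mul_pow 4 (s * (1 - s))]; ring
      _ ≤ r ^ k * w s ^ (-l) * 1 := by
          refine mul_le_mul_of_nonneg_left ?_ (by positivity)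
          exact pow_le_one₀ (by positivity) ((div_le_one hws).2 h4)
      _ = _ := mul_one _
  · exact ae_of_all _ fun s _ => hgeo.summable.mul_right _
  · simp_rw [tsum_mul_right]
    refine ContinuousOn.intervalIntegrable ?_
    rw [uIcc_of_le zero_le_one]
    exact continuousOn_const.mul (hpow _)
  · refine ae_of_all _ fun s hs => ?_
    have hs := hsub hs
    have hws : 0 < w s := kernel_pos hs hz
    have hss : 0 ≤ s * (1 - s) := mul_nonneg hs.1 (sub_nonneg.2 hs.2)
    have h4 := mul_one_sub_le_kernel s z
    have hx0 : 0 ≤ 4 * (s * (1 - s)) * r / w s := by positivity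
    have hx : |4 * (s * (1 - s)) * r / w s| < 1 := by
      rw [abs_of_nonneg hx0, div_lt_one hws]
      nlinarith [mul_le_mul_of_nonneg_right h4 hr, mul_lt_mul_of_pos_left hr1 hws]
    have := (hasSum_poch_binomial l hx).mul_right (w s ^ (-l))
    rw [← Real.mul_rpow (by positivity) hws.le, one_add_mul, div_mul_cancel₀ _ hws.ne'] at this
    refine this.congr_fun fun k => ?_
    rw [neg_add, ← sub_eq_add_neg, Real.rpow_sub hws, Real.rpow_natCast, neg_pow (4 * r),
      neg_pow (_ / _), div_pow, mul_pow (4 * (s * (1 - s))), mul_pow 4 (s * (1 - s)), mul_pow 4 r]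
    ring

/-- Coefficients of the double expansion of the Feynman-parameter integral. -/
noncomputable def massCoeff (l : ℝ) (k n : ℕ) : ℝ :=
  poch l (k + n) * poch (l - 1 / 2) n / (poch (3 / 2) (k + n) * n.factorial)

/-- The left side is the Beta value `B(k+1, k+1)`. In this form its `4^k` cancels against the
binomial expansion and its `(3/2)_k` merges into `(3/2)_(k+n)`. -/
theorem factorial_sq_div (k : ℕ) :
    (k.factorial : ℝ) ^ 2 / (2 * k + 1).factorial = k.factorial / (4 ^ k * poch (3 / 2) k) := by
  have h3 : ∀ j, poch (3 / 2) j ≠ 0 := fun j => (poch_pos (by norm_num) j).ne'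
  induction k with
  | zero => simp
  | succ k ih =>
    have := h3 k
    have hk : (k.factorial : ℝ) ≠ 0 := by positivity
    have hk1 : ((2 * k + 1).factorial : ℝ) ≠ 0 := by positivity
    rw [div_eq_div_iff hk1 (by positivity)] at ih
    have ih' : (k.factorial : ℝ) * (4 ^ k * poch (3 / 2) k) = (2 * k + 1).factorial := by
      apply mul_left_cancel₀ hk; linear_combination ih
    rw [show 2 * (k + 1) + 1 = 2 * k + 1 + 1 + 1 by ring, Nat.factorial_succ (2 * k + 1 + 1),
      Nat.factorial_succ (2 * k + 1), Nat.factorial_succ k, poch_succ]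
    push_cast
    rw [← ih']
    field_simp
    ring

theorem poch_mul_meanCoeff (l : ℝ) (k n : ℕ) :
    poch l k / k.factorial * 4 ^ k * meanCoeff k (l + k) n = massCoeff l k n := by
  have h3 : ∀ j, poch (3 / 2) j ≠ 0 := fun j => (poch_pos (by norm_num) j).ne'
  have hk : (k.factorial : ℝ) ≠ 0 := by positivity
  have h4 := h3 (k + n)
  rw [poch_add] at h4
  rw [meanCoeff, massCoeff, factorial_sq_div, poch_add, poch_add,
    show l + k - k - 1 / 2 = l - 1 / 2 by ring, add_comm (k : ℝ) (3 / 2)]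
  have := h3 k
  have := right_ne_zero_of_mul h4
  field_simp

/-- Any polynomial bound suffices against two geometric factors. Since `l < 2`, one has `(l)_j ≤
(j+1) (3/2)_j` and `|(l - 1/2)_j| ≤ (j+1)!`. -/
theorem abs_massCoeff_le {l : ℝ} (hl : 0 < l) (hl2 : l < 2) (k n : ℕ) :
    |massCoeff l k n| ≤ (k + 1) * (n + 1) ^ 2 := by
  have h1 : ∀ j : ℕ, poch l j ≤ (j + 1) * poch (3 / 2) j := by
    intro j
    induction j with
    | zero => simp
    | succ j ih =>
      have hp := poch_pos (by norm_num : (0 : ℝ) < 3 / 2) j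
      rw [poch_succ, poch_succ]
      calc poch l j * (l + j) ≤ ((j + 1) * poch (3 / 2) j) * (2 + j) := by
            gcongr
        _ ≤ _ := by push_cast; nlinarith [mul_nonneg hp.le (Nat.cast_nonneg (α := ℝ) j)]
  have h2 : ∀ j : ℕ, |poch (l - 1 / 2) j| ≤ (j + 1) * j.factorial := by
    intro j
    induction j with
    | zero => simp
    | succ j ih =>
      have hj : (0 : ℝ) ≤ j := j.cast_nonneg
      have : |l - 1 / 2 + j| ≤ j + 2 := abs_le.2 ⟨by linarith, by linarith⟩
      rw [poch_succ, abs_mul, Nat.factorial_succ]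
      calc _ ≤ ((j + 1) * j.factorial) * ((j : ℝ) + 2) := by gcongr
        _ = _ := by push_cast; ring
  have hp := poch_pos (by norm_num : (0 : ℝ) < 3 / 2) (k + n)
  have hn : (0 : ℝ) < n.factorial := by positivity
  rw [massCoeff, abs_div, abs_mul, abs_of_pos (poch_pos hl _), abs_of_pos (mul_pos hp hn),
    div_le_iff₀ (mul_pos hp hn)]
  have h3 := h1 (k + n)
  push_cast at h3
  have hkn : (k : ℝ) + n + 1 ≤ (k + 1) * (n + 1) := by
    nlinarith [mul_nonneg (Nat.cast_nonneg (α := ℝ) k) (Nat.cast_nonneg (α := ℝ) n)]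
  calc poch l (k + n) * |poch (l - 1 / 2) n|
      ≤ ((k + 1) * (n + 1) * poch (3 / 2) (k + n)) * ((n + 1) * n.factorial) := by
        refine mul_le_mul (h3.trans ?_) (h2 n) (abs_nonneg _) (by positivity)
        exact mul_le_mul_of_nonneg_right hkn hp.le
    _ = _ := by ring

theorem summable_abs_massCoeff {l : ℝ} (hl : 0 < l) (hl2 : l < 2) {r x : ℝ} (hr : |r| < 1)
    (hx : |x| < 1) :
    Summable fun j : ℕ × ℕ => |massCoeff l j.1 j.2 * r ^ j.1 * x ^ j.2| := by
  have s1 : Summable fun k : ℕ => ((k : ℝ) + 1) * |r| ^ k := by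
    have h := (summable_pow_mul_geometric_of_norm_lt_one 1 (r := |r|) (by simpa using hr)).add
      (summable_geometric_of_lt_one (abs_nonneg r) hr)
    refine h.congr fun k => ?_
    ring
  have s2 : Summable fun n : ℕ => ((n : ℝ) + 1) ^ 2 * |x| ^ n := by
    have hx' : ‖|x|‖ < 1 := by simpa using hx
    have h := ((summable_pow_mul_geometric_of_norm_lt_one 2 hx').add
      ((summable_pow_mul_geometric_of_norm_lt_one 1 hx').mul_left 2)).add
      (summable_geometric_of_lt_one (abs_nonneg x) hx)
    refine h.congr fun k => ?_
    ring
  refine Summable.of_nonneg_of_le (fun _ => abs_nonneg _) (fun j => ?_)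
    (s1.mul_of_nonneg s2 (fun _ => by positivity) (fun _ => by positivity))
  rw [abs_mul, abs_mul, abs_pow, abs_pow]
  calc _ ≤ ((j.1 + 1) * (j.2 + 1) ^ 2) * |r| ^ j.1 * |x| ^ j.2 := by
        gcongr; exact abs_massCoeff_le hl hl2 _ _
    _ = _ := by ring

/-- Absolute summability allows summing over `n` first. The inner sums are the means of
`hasSum_meanCoeff` with exponent `l + k`, and the outer sum is the binomial expansion. -/
theorem hasSum_massCoeff_normalized {l : ℝ} (hl : 0 < l) (hl2 : l < 2) {r : ℝ} (hr : 0 ≤ r)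
    (hr1 : r < 1) {z : ℝ} (hz : |z| < 1) :
    HasSum (fun j : ℕ × ℕ => massCoeff l j.1 j.2 * (-r) ^ j.1 * (z ^ 2) ^ j.2)
      (∫ s in (0 : ℝ)..1,
        (1 + 2 * (2 * s - 1) * z + z ^ 2 + 4 * (s * (1 - s)) * r) ^ (-l)) := by
  have hs := (summable_abs_massCoeff hl hl2 (r := -r) (x := z ^ 2)
    (by rwa [abs_neg, abs_of_nonneg hr]) (by rwa [abs_pow, sq_lt_one_iff₀ (abs_nonneg _)])).of_abs
  have h1 := hs.hasSum.prod_fiberwise (g := fun k : ℕ => poch l k / k.factorial * (-(4 * r)) ^ k *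
        ∫ s in (0 : ℝ)..1, (s * (1 - s)) ^ k * (1 + 2 * (2 * s - 1) * z + z ^ 2) ^ (-(l + k)))
    fun k => by
      have := (hasSum_meanCoeff k (l + k) hz).mul_left (poch l k / k.factorial * (-(4 * r)) ^ k)
      refine this.congr_fun fun n => ?_
      rw [← poch_mul_meanCoeff, pow_mul, neg_pow r, neg_pow (4 * r), mul_pow]
      ring
  rw [(hasSum_integral_binomial hl hr hr1 hz).unique h1]
  exact hs.hasSum

/-- Feynman-parameter integral of the bubble with masses `κ₁`, `κ₂`. -/
noncomputable def massIntegral (l p κ₁ κ₂ : ℝ) : ℝ :=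
  ∫ s in (0 : ℝ)..1, (s * (1 - s) * p ^ 2 + s * κ₁ ^ 2 + (1 - s) * κ₂ ^ 2) ^ (-l)

/-- The `(k, n)` term of the expansion of `massIntegral`, in terms of the half sum `S` and half
difference `δ` of the masses. -/
noncomputable def massTerm (l p S δ : ℝ) (j : ℕ × ℕ) : ℝ :=
  massCoeff l j.1 j.2 * (-(p ^ 2 / 4)) ^ j.1 * δ ^ (2 * j.2) * S ^ (-(2 * (l + j.1 + j.2)))

theorem massTerm_eq (l p : ℝ) {S : ℝ} (hS : 0 < S) (δ : ℝ) (j : ℕ × ℕ) :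
    massTerm l p S δ j = S ^ (-(2 * l)) *
      (massCoeff l j.1 j.2 * (-(p ^ 2 / (4 * S ^ 2))) ^ j.1 * ((δ / S) ^ 2) ^ j.2) := by
  have e : S ^ (-(2 * (l + j.1 + j.2))) = S ^ (-(2 * l)) / ((S ^ 2) ^ j.1 * (S ^ 2) ^ j.2) := by
    rw [show -(2 * (l + j.1 + j.2)) = -(2 * l) - ((2 * j.1 + 2 * j.2 : ℕ) : ℝ) by push_cast; ring,
      Real.rpow_sub hS, Real.rpow_natCast, pow_add, pow_mul, pow_mul]
  rw [massTerm, e, pow_mul, ← div_div, neg_div', div_pow δ, div_pow (δ ^ 2), neg_div', div_pow,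
    div_pow, mul_pow]
  field_simp

theorem summable_abs_massTerm {l : ℝ} (hl : 0 < l) (hl2 : l < 2) {p S δ : ℝ} (hδ : |δ| < S)
    (hp : p ^ 2 < 4 * S ^ 2) : Summable fun j => |massTerm l p S δ j| := by
  have hS : 0 < S := (abs_nonneg δ).trans_lt hδ
  refine ((summable_abs_massCoeff hl hl2 (r := -(p ^ 2 / (4 * S ^ 2))) (x := (δ / S) ^ 2)
    ?_ ?_).mul_left |S ^ (-(2 * l))|).congr fun j => ?_
  · rw [abs_neg, abs_of_nonneg (by positivity), div_lt_one (by positivity)]; exact hp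
  · rw [abs_pow, sq_lt_one_iff₀ (abs_nonneg _), abs_div, abs_of_pos hS, div_lt_one hS]; exact hδ
  · rw [massTerm_eq l p hS, abs_mul (S ^ _)]

theorem hasSum_massTerm {l : ℝ} (hl : 0 < l) (hl2 : l < 2) {p κ₁ κ₂ : ℝ} (h1 : 0 < κ₁)
    (h2 : 0 < κ₂) (hp : p ^ 2 < (κ₁ + κ₂) ^ 2) :
    HasSum (massTerm l p ((κ₁ + κ₂) / 2) ((κ₁ - κ₂) / 2)) (massIntegral l p κ₁ κ₂) := by
  set S := (κ₁ + κ₂) / 2 with hSdef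
  set δ := (κ₁ - κ₂) / 2 with hδdef
  have hS : 0 < S := by positivity
  have hz : |δ / S| < 1 := by
    rw [abs_div, abs_of_pos hS, div_lt_one hS, abs_lt]
    constructor <;> rw [hSdef, hδdef] <;> linarith
  have hr1 : p ^ 2 / (4 * S ^ 2) < 1 := by
    rw [div_lt_one (by positivity), hSdef]; linarith
  have h := (hasSum_massCoeff_normalized hl hl2 (by positivity) hr1 hz).mul_left (S ^ (-(2 * l)))
  -- Substituting `κ₁ = S + δ`, `κ₂ = S - δ` and pulling out `S²` normalizes the kernel.
  have e : massIntegral l p κ₁ κ₂ = S ^ (-(2 * l)) * ∫ s in (0 : ℝ)..1,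
      (1 + 2 * (2 * s - 1) * (δ / S) + (δ / S) ^ 2 +
        4 * (s * (1 - s)) * (p ^ 2 / (4 * S ^ 2))) ^ (-l) := by
    rw [massIntegral, ← intervalIntegral.integral_const_mul]
    refine intervalIntegral.integral_congr fun s hs => ?_
    rw [uIcc_of_le zero_le_one] at hs
    have hk := kernel_pos hs hz
    have hss : 0 ≤ s * (1 - s) := mul_nonneg hs.1 (sub_nonneg.2 hs.2)
    change _ = S ^ (-(2 * l)) * (_ : ℝ) ^ (-l)
    rw [show -(2 * l) = 2 * -l by ring, Real.rpow_mul hS.le, Real.rpow_two,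
      ← Real.mul_rpow (by positivity) (by positivity)]
    congr 1
    field_simp
    rw [hSdef, hδdef]; ring
  rw [e]
  exact h.congr_fun fun j => massTerm_eq l p hS δ j

/-! ### The inner integral -/

theorem convex_comb_pos {A B s : ℝ} (hA : 0 < A) (hB : 0 < B) (hs : s ∈ Icc (0 : ℝ) 1) :
    0 < s * A + (1 - s) * B := by
  rcases hs.1.eq_or_lt with h | h
  · subst h; simpa
  · have := mul_nonneg (sub_nonneg.2 hs.2) hB.le
    have := mul_pos h hA
    linarith

theorem lintegral_unit_eq_of_hasDerivAt {f F : ℝ → ℝ} {c : ℝ} (hf : ContinuousOn f (Icc 0 1))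
    (hf0 : ∀ s ∈ Icc (0 : ℝ) 1, 0 ≤ f s) (hF : ∀ s ∈ Icc (0 : ℝ) 1, HasDerivAt F (f s) s)
    (hc : F 1 - F 0 = c) : ∫⁻ s in Ioc (0 : ℝ) 1, ENNReal.ofReal (f s) = ENNReal.ofReal c := by
  have hi : IntervalIntegrable f volume 0 1 := by
    refine ContinuousOn.intervalIntegrable ?_
    rwa [uIcc_of_le zero_le_one]
  have h := intervalIntegral.integral_eq_sub_of_hasDerivAt (f := F) (f' := f)
    (by rwa [uIcc_of_le zero_le_one]) hi
  rw [← hc, ← h, intervalIntegral.integral_of_le zero_le_one, ofReal_integral_eq_lintegral_ofReal]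
  · exact (intervalIntegrable_iff_integrableOn_Ioc_of_le zero_le_one).1 hi
  · filter_upwards [ae_restrict_mem measurableSet_Ioc] with s hs
    exact hf0 s (Ioc_subset_Icc_self hs)

theorem continuousOn_convex_comb_rpow {A B : ℝ} (hA : 0 < A) (hB : 0 < B) (ν : ℝ) :
    ContinuousOn (fun s : ℝ => (s * A + (1 - s) * B) ^ ν) (Icc 0 1) :=
  ContinuousOn.rpow_const (by fun_prop) fun _ hs => Or.inl (convex_comb_pos hA hB hs).ne'

/-- Feynman's parametrization of a product of two propagators. -/
theorem lintegral_feynman_two {A B : ℝ} (hA : 0 < A) (hB : 0 < B) :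
    ∫⁻ s in Ioc (0 : ℝ) 1, ENNReal.ofReal ((s * A + (1 - s) * B) ^ (-2 : ℝ)) =
      ENNReal.ofReal (1 / A * (1 / B)) := by
  -- With `C = sA + (1-s)B`, this is `(1/B - 1/C)/(A - B)` after cancelling `A - B`, so the case `A
  -- = B` is included.
  refine lintegral_unit_eq_of_hasDerivAt (F := fun s => s / (B * (s * A + (1 - s) * B)))
    (continuousOn_convex_comb_rpow hA hB _)
    (fun s hs => Real.rpow_nonneg (convex_comb_pos hA hB hs).le _) (fun s hs => ?_) ?_
  · have hC := convex_comb_pos hA hB hs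
    have h1 : HasDerivAt (fun s : ℝ => B * (s * A + (1 - s) * B)) (B * (A - B)) s := by
      have := (((hasDerivAt_id s).mul_const A).add
        (((hasDerivAt_id s).const_sub 1).mul_const B)).const_mul B
      convert! this using 1; ring
    convert! (hasDerivAt_id s).div h1 (by positivity) using 1
    rw [show (-2 : ℝ) = -((2 : ℕ) : ℝ) by norm_num, Real.rpow_neg hC.le, Real.rpow_natCast, id]
    field_simp
    ring
  · simp

/-- Differentiated form of Feynman's parametrization. -/
theorem lintegral_feynman_three {A B : ℝ} (hA : 0 < A) (hB : 0 < B) :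
    ∫⁻ s in Ioc (0 : ℝ) 1, ENNReal.ofReal (2 * (s * A + (1 - s) * B) ^ (-3 : ℝ)) =
      ENNReal.ofReal (1 / (A ^ 2 * B) + 1 / (A * B ^ 2)) := by
  -- Likewise `(1/B² - 1/C²)/(A - B)` with `A - B` cancelled.
  refine lintegral_unit_eq_of_hasDerivAt
    (F := fun s => s * ((s * A + (1 - s) * B) + B) / (B ^ 2 * (s * A + (1 - s) * B) ^ 2))
    ((continuousOn_convex_comb_rpow hA hB _).const_smul (2 : ℝ))
    (fun s hs => mul_nonneg two_pos.le (Real.rpow_nonneg (convex_comb_pos hA hB hs).le _))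
    (fun s hs => ?_) ?_
  · have hC := convex_comb_pos hA hB hs
    have h0 : HasDerivAt (fun s : ℝ => s * A + (1 - s) * B) (A - B) s := by
      have := (((hasDerivAt_id s).mul_const A).add
        (((hasDerivAt_id s).const_sub 1).mul_const B))
      convert! this using 1; ring
    convert! ((hasDerivAt_id s).mul (h0.add_const B)).div ((h0.pow 2).const_mul (B ^ 2))
      (mul_pos (pow_pos hB 2) (pow_pos hC 2)).ne' using 1
    simp only [id, Pi.mul_apply, Pi.pow_apply]
    rw [show (-3 : ℝ) = -((3 : ℕ) : ℝ) by norm_num, Real.rpow_neg hC.le, Real.rpow_natCast]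
    field_simp
    ring
  · simp only [one_mul, sub_self, zero_mul, add_zero, zero_div, sub_zero]
    field_simp
    ring

/-- The squared mass in Feynman's parametrization. -/
noncomputable def feynmanMass (p κ₁ κ₂ s : ℝ) : ℝ :=
  s * (1 - s) * p ^ 2 + s * κ₁ ^ 2 + (1 - s) * κ₂ ^ 2

theorem feynmanMass_pos (p : ℝ) {κ₁ κ₂ : ℝ} (h1 : 0 < κ₁) (h2 : 0 < κ₂) {s : ℝ}
    (hs : s ∈ Icc (0 : ℝ) 1) : 0 < feynmanMass p κ₁ κ₂ s := by
  have := convex_comb_pos (pow_pos h1 2) (pow_pos h2 2) hs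
  have := mul_nonneg (mul_nonneg hs.1 (sub_nonneg.2 hs.2)) (sq_nonneg p)
  unfold feynmanMass
  linarith

theorem continuous_feynmanMass (p κ₁ κ₂ : ℝ) : Continuous (feynmanMass p κ₁ κ₂) := by
  unfold feynmanMass; fun_prop

theorem massIntegral_nonneg (l p : ℝ) {κ₁ κ₂ : ℝ} (h1 : 0 < κ₁) (h2 : 0 < κ₂) :
    0 ≤ massIntegral l p κ₁ κ₂ :=
  intervalIntegral.integral_nonneg zero_le_one fun _ hs =>
    Real.rpow_nonneg (feynmanMass_pos p h1 h2 hs).le _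

theorem lintegral_feynmanMass_rpow (l p : ℝ) {κ₁ κ₂ : ℝ} (h1 : 0 < κ₁) (h2 : 0 < κ₂) :
    ∫⁻ s in Ioc (0 : ℝ) 1, ENNReal.ofReal (feynmanMass p κ₁ κ₂ s ^ (-l)) =
      ENNReal.ofReal (massIntegral l p κ₁ κ₂) := by
  have hc : ContinuousOn (fun s => feynmanMass p κ₁ κ₂ s ^ (-l)) (Icc 0 1) :=
    (continuous_feynmanMass p κ₁ κ₂).continuousOn.rpow_const fun s hs =>
      Or.inl (feynmanMass_pos p h1 h2 hs).ne'
  rw [massIntegral, intervalIntegral.integral_of_le zero_le_one,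
    ofReal_integral_eq_lintegral_ofReal]
  · rfl
  · exact (hc.integrableOn_Icc).mono_set Ioc_subset_Icc_self
  · filter_upwards [ae_restrict_mem measurableSet_Ioc] with s hs
    exact Real.rpow_nonneg (feynmanMass_pos p h1 h2 (Ioc_subset_Icc_self hs)).le _

theorem hasDerivAt_innerIntegrand (p : ℝ) {κ₁ κ₂ : ℝ} (h1 : 0 < κ₁) (h2 : 0 < κ₂) (x : ℝ) {u : ℝ}
    (hu : 0 ≤ u) : HasDerivAt (innerIntegrand p (κ₁ ^ 2) (κ₂ ^ 2) x)
      (-(1 / ((x ^ 2 + u + κ₁ ^ 2) ^ 2 * ((x + p) ^ 2 + u + κ₂ ^ 2)) +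
        1 / ((x ^ 2 + u + κ₁ ^ 2) * ((x + p) ^ 2 + u + κ₂ ^ 2) ^ 2))) u := by
  have hA : 0 < x ^ 2 + u + κ₁ ^ 2 := by positivity
  have hB : 0 < (x + p) ^ 2 + u + κ₂ ^ 2 := by positivity
  have d1 : HasDerivAt (fun u => x ^ 2 + u + κ₁ ^ 2) 1 u :=
    ((hasDerivAt_id u).const_add _).add_const _
  have d2 : HasDerivAt (fun u => (x + p) ^ 2 + u + κ₂ ^ 2) 1 u :=
    ((hasDerivAt_id u).const_add _).add_const _
  have := (d1.inv hA.ne').mul (d2.inv hB.ne')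
  have e : innerIntegrand p (κ₁ ^ 2) (κ₂ ^ 2) x =
      (fun u => x ^ 2 + u + κ₁ ^ 2)⁻¹ * (fun u => (x + p) ^ 2 + u + κ₂ ^ 2)⁻¹ := by
    ext u; simp [innerIntegrand]
  rw [e]
  convert! this using 1
  simp only [Pi.inv_apply]
  field_simp
  ring

/-- After Feynman parametrization the square in `x` is completed, and Tonelli lets the `u`-integral,
a Beta integral, come first. The `x`-integral follows by translation; it converges precisely because
`D < 4`. -/
theorem lintegral_inner {D : ℝ} (hD : 0 < D) (hD4 : D < 4) (p : ℝ) {κ₁ κ₂ : ℝ} (h1 : 0 < κ₁)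
    (h2 : 0 < κ₂) :
    ∫⁻ x : ℝ, ∫⁻ u in Ioi (0 : ℝ), ENNReal.ofReal (u ^ ((D - 1) / 2) *
      (1 / ((x ^ 2 + u + κ₁ ^ 2) ^ 2 * ((x + p) ^ 2 + u + κ₂ ^ 2)) +
        1 / ((x ^ 2 + u + κ₁ ^ 2) * ((x + p) ^ 2 + u + κ₂ ^ 2) ^ 2))) =
    ENNReal.ofReal (Real.Gamma ((D + 1) / 2) * √Real.pi * Real.Gamma ((4 - D) / 2) *
      massIntegral ((4 - D) / 2) p κ₁ κ₂) := by
  have hm1 : Measurable (fun s => feynmanMass p κ₁ κ₂ s) :=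
    (continuous_feynmanMass p κ₁ κ₂).measurable
  have hg : 0 < Real.Gamma ((D + 1) / 2) := Real.Gamma_pos_of_pos (by linarith)
  have hg2 : 0 < Real.Gamma ((5 - D) / 2) := Real.Gamma_pos_of_pos (by linarith)
  have hgl : 0 < Real.Gamma ((4 - D) / 2) := Real.Gamma_pos_of_pos (by linarith)
  calc _ = ∫⁻ x : ℝ, ∫⁻ u in Ioi (0 : ℝ), ∫⁻ s in Ioc (0 : ℝ) 1, ENNReal.ofReal
        (2 * (u ^ ((D - 1) / 2) * (u + ((x + (1 - s) * p) ^ 2 + feynmanMass p κ₁ κ₂ s)) ^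
          (-3 : ℝ))) := by
        refine lintegral_congr fun x => setLIntegral_congr_fun measurableSet_Ioi fun u hu => ?_
        have hu : (0 : ℝ) < u := hu
        have hup : 0 ≤ u ^ ((D - 1) / 2) := Real.rpow_nonneg hu.le _
        rw [ENNReal.ofReal_mul hup, ← lintegral_feynman_three (by positivity) (by positivity),
          ← lintegral_const_mul _ (by fun_prop)]
        refine lintegral_congr fun s => ?_
        rw [← ENNReal.ofReal_mul hup]
        congr 1
        rw [show s * (x ^ 2 + u + κ₁ ^ 2) + (1 - s) * ((x + p) ^ 2 + u + κ₂ ^ 2) =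
          u + ((x + (1 - s) * p) ^ 2 + feynmanMass p κ₁ κ₂ s) by unfold feynmanMass; ring]
        ring
    _ = ∫⁻ x : ℝ, ∫⁻ s in Ioc (0 : ℝ) 1, ∫⁻ u in Ioi (0 : ℝ), ENNReal.ofReal
        (2 * (u ^ ((D - 1) / 2) * (u + ((x + (1 - s) * p) ^ 2 + feynmanMass p κ₁ κ₂ s)) ^
          (-3 : ℝ))) := by
        refine lintegral_congr fun x => lintegral_lintegral_swap ?_
        refine Measurable.aemeasurable ?_
        fun_prop
    _ = ∫⁻ x : ℝ, ∫⁻ s in Ioc (0 : ℝ) 1, ENNReal.ofReal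
        (Real.Gamma ((D + 1) / 2) * Real.Gamma ((5 - D) / 2) *
          ((x + (1 - s) * p) ^ 2 + feynmanMass p κ₁ κ₂ s) ^ (-((5 - D) / 2))) := by
        refine lintegral_congr fun x => setLIntegral_congr_fun measurableSet_Ioc fun s hs => ?_
        have hF := feynmanMass_pos p h1 h2 (Ioc_subset_Icc_self hs)
        have h := lintegral_rpow_mul_add_rpow (s := (D + 1) / 2) (N := 3)
          (C := (x + (1 - s) * p) ^ 2 + feynmanMass p κ₁ κ₂ s) (by linarith) (by linarith)
          (by positivity)
        rw [show (D + 1) / 2 - 1 = (D - 1) / 2 by ring, show 3 - (D + 1) / 2 = (5 - D) / 2 by ring,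
          show (D + 1) / 2 - 3 = -((5 - D) / 2) by ring] at h
        simp only [ENNReal.ofReal_mul two_pos.le]
        rw [lintegral_const_mul _ (by fun_prop), h, ← ENNReal.ofReal_mul two_pos.le]
        have hG3 : Real.Gamma 3 = 2 := by
          rw [show (3 : ℝ) = (2 : ℕ) + 1 by norm_num, Real.Gamma_nat_eq_factorial]; norm_num
        rw [hG3]
        congr 1
        ring
    _ = ∫⁻ s in Ioc (0 : ℝ) 1, ∫⁻ x : ℝ, ENNReal.ofReal
        (Real.Gamma ((D + 1) / 2) * Real.Gamma ((5 - D) / 2) *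
          ((x + (1 - s) * p) ^ 2 + feynmanMass p κ₁ κ₂ s) ^ (-((5 - D) / 2))) := by
        refine lintegral_lintegral_swap ?_
        refine Measurable.aemeasurable ?_
        fun_prop
    _ = ∫⁻ s in Ioc (0 : ℝ) 1, ENNReal.ofReal
          (Real.Gamma ((D + 1) / 2) * √Real.pi * Real.Gamma ((4 - D) / 2)) *
          ENNReal.ofReal (feynmanMass p κ₁ κ₂ s ^ (-((4 - D) / 2))) := by
        refine setLIntegral_congr_fun measurableSet_Ioc fun s hs => ?_
        have hF := feynmanMass_pos p h1 h2 (Ioc_subset_Icc_self hs)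
        have h := lintegral_pow_mul_sq_add_rpow 0 (N := (5 - D) / 2)
          (C := feynmanMass p κ₁ κ₂ s) (by norm_num; linarith) hF
        simp only [mul_zero, pow_zero, one_mul, Nat.cast_zero, zero_add,
          Real.Gamma_one_half_eq] at h
        rw [show (5 - D) / 2 - 1 / 2 = (4 - D) / 2 by ring,
          show 1 / 2 - (5 - D) / 2 = -((4 - D) / 2) by ring] at h
        have hK : 0 ≤ Real.Gamma ((D + 1) / 2) * Real.Gamma ((5 - D) / 2) := by positivity
        simp only [ENNReal.ofReal_mul hK]
        rw [lintegral_const_mul _ (by fun_prop), lintegral_add_right_eq_self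
          (fun x => ENNReal.ofReal ((x ^ 2 + feynmanMass p κ₁ κ₂ s) ^ (-((5 - D) / 2)))), h,
          ← ENNReal.ofReal_mul hK, ← ENNReal.ofReal_mul (by positivity)]
        congr 1
        field_simp
    _ = _ := by
        rw [lintegral_const_mul _ (by fun_prop), lintegral_feynmanMass_rpow _ _ h1 h2,
          ← ENNReal.ofReal_mul (by positivity)]

theorem ae_snd_pos : ∀ᵐ z : ℝ × ℝ ∂((volume : Measure ℝ).prod (volume.restrict (Ioi (0 : ℝ)))),
    0 < z.2 := by
  have : ∀ᵐ u ∂(volume.restrict (Ioi (0 : ℝ))), 0 < u := ae_restrict_mem measurableSet_Ioi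
  exact Measure.quasiMeasurePreserving_snd.ae this

theorem integrable_and_integral_inner {D : ℝ} (hD : 0 < D) (hD4 : D < 4) (p : ℝ) {κ₁ κ₂ : ℝ}
    (h1 : 0 < κ₁) (h2 : 0 < κ₂) :
    Integrable (fun z : ℝ × ℝ => -(z.2 ^ ((D - 1) / 2) *
        deriv (innerIntegrand p (κ₁ ^ 2) (κ₂ ^ 2) z.1) z.2))
      ((volume : Measure ℝ).prod (volume.restrict (Ioi (0 : ℝ)))) ∧
    ∫ z : ℝ × ℝ, -(z.2 ^ ((D - 1) / 2) * deriv (innerIntegrand p (κ₁ ^ 2) (κ₂ ^ 2) z.1) z.2)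
      ∂((volume : Measure ℝ).prod (volume.restrict (Ioi (0 : ℝ)))) =
      Real.Gamma ((D + 1) / 2) * √Real.pi * Real.Gamma ((4 - D) / 2) *
        massIntegral ((4 - D) / 2) p κ₁ κ₂ := by
  have hg : 0 < Real.Gamma ((D + 1) / 2) := Real.Gamma_pos_of_pos (by linarith)
  have hgl : 0 < Real.Gamma ((4 - D) / 2) := Real.Gamma_pos_of_pos (by linarith)
  set F : ℝ × ℝ → ℝ := fun z => z.2 ^ ((D - 1) / 2) *
      (1 / ((z.1 ^ 2 + z.2 + κ₁ ^ 2) ^ 2 * ((z.1 + p) ^ 2 + z.2 + κ₂ ^ 2)) +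
        1 / ((z.1 ^ 2 + z.2 + κ₁ ^ 2) * ((z.1 + p) ^ 2 + z.2 + κ₂ ^ 2) ^ 2)) with hF
  have hFm : Measurable F := by fun_prop
  have hEq : (fun z : ℝ × ℝ => -(z.2 ^ ((D - 1) / 2) *
        deriv (innerIntegrand p (κ₁ ^ 2) (κ₂ ^ 2) z.1) z.2))
      =ᵐ[(volume : Measure ℝ).prod (volume.restrict (Ioi (0 : ℝ)))] F := by
    filter_upwards [ae_snd_pos] with z hz
    rw [(hasDerivAt_innerIntegrand p h1 h2 z.1 hz.le).deriv, hF]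
    ring
  have key := integrable_and_integral_eq_of_lintegral
    (ν := (volume : Measure ℝ).prod (volume.restrict (Ioi (0 : ℝ)))) (f := F)
    (c := Real.Gamma ((D + 1) / 2) * √Real.pi * Real.Gamma ((4 - D) / 2) *
        massIntegral ((4 - D) / 2) p κ₁ κ₂) hFm.aestronglyMeasurable ?_ ?_ ?_
  · exact ⟨key.1.congr hEq.symm, (integral_congr_ae hEq).trans key.2⟩
  · filter_upwards [ae_snd_pos] with z hz
    have := Real.rpow_nonneg hz.le ((D - 1) / 2)
    simp only [hF, Pi.zero_apply]
    positivity
  · have := massIntegral_nonneg ((4 - D) / 2) p h1 h2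
    positivity
  · rw [lintegral_prod _ (by fun_prop)]
    exact lintegral_inner hD hD4 p h1 h2

theorem dimIntegrable_innerIntegrand {D : ℝ} (hD : 0 < D) (hD4 : D < 4) (p : ℝ) {κ₁ κ₂ : ℝ}
    (h1 : 0 < κ₁) (h2 : 0 < κ₂) : DimIntegrable D (innerIntegrand p (κ₁ ^ 2) (κ₂ ^ 2)) := by
  refine ⟨ae_of_all _ fun x u hu => (hasDerivAt_innerIntegrand p h1 h2 x hu.le).differentiableAt,
    ae_of_all _ fun x => ?_, ?_⟩
  · have t1 : Tendsto (fun u => 1 / (x ^ 2 + u + κ₁ ^ 2)) atTop (𝓝 0) :=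
      tendsto_const_nhds.div_atTop
        (tendsto_atTop_add_const_right _ _ (tendsto_atTop_add_const_left _ _ tendsto_id))
    have t2 : Tendsto (fun u => 1 / ((x + p) ^ 2 + u + κ₂ ^ 2)) atTop (𝓝 0) :=
      tendsto_const_nhds.div_atTop
        (tendsto_atTop_add_const_right _ _ (tendsto_atTop_add_const_left _ _ tendsto_id))
    have h := t1.mul t2
    rw [mul_zero] at h
    exact h
  · simpa using (integrable_and_integral_inner hD hD4 p h1 h2).1.neg

/-- `dimIntegral` as one integral over the half-plane. -/
theorem dimIntegral_eq_integral_prod {D : ℝ} {f : ℝ → ℝ → ℝ} (hf : DimIntegrable D f) :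
    dimIntegral D f = Real.pi ^ ((D - 1) / 2) / Real.Gamma ((D + 1) / 2) *
      ∫ z : ℝ × ℝ, -(z.2 ^ ((D - 1) / 2) * deriv (f z.1) z.2)
        ∂((volume : Measure ℝ).prod (volume.restrict (Ioi (0 : ℝ)))) := by
  rw [integral_neg, integral_prod _ hf.2.2, dimIntegral]
  simp only [radialIntegral]
  rw [integral_const_mul, show (D - 1) / 2 + 1 = (D + 1) / 2 by ring]
  ring

theorem dimIntegral_innerIntegrand {D : ℝ} (hD : 0 < D) (hD4 : D < 4) (p : ℝ) {κ₁ κ₂ : ℝ}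
    (h1 : 0 < κ₁) (h2 : 0 < κ₂) : dimIntegral D (innerIntegrand p (κ₁ ^ 2) (κ₂ ^ 2)) =
      Real.pi ^ (D / 2) * Real.Gamma ((4 - D) / 2) * massIntegral ((4 - D) / 2) p κ₁ κ₂ := by
  have hg : 0 < Real.Gamma ((D + 1) / 2) := Real.Gamma_pos_of_pos (by linarith)
  rw [dimIntegral_eq_integral_prod (dimIntegrable_innerIntegrand hD hD4 p h1 h2),
    (integrable_and_integral_inner hD hD4 p h1 h2).2]
  have e : Real.pi ^ (D / 2) = Real.pi ^ ((D - 1) / 2) * √Real.pi := by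
    rw [Real.sqrt_eq_rpow, ← Real.rpow_add Real.pi_pos]; congr 1; ring
  rw [e]
  field_simp

/-! ### Moments in the outer momentum and the double series -/

/-- Besides exchanging sum and integral this gives integrability of the sum, from `∫|f| ≤ ∑ ∫|F i|`;
absolute convergence of the loop integral rests on it. -/
theorem integrable_and_hasSum_integral {Ω ι : Type*} [Countable ι] [MeasurableSpace Ω]
    {ν : Measure Ω} {F : ι → Ω → ℝ} {f : Ω → ℝ} (hF : ∀ i, Integrable (F i) ν)
    (hs : Summable fun i => ∫ x, ‖F i x‖ ∂ν) (hf : ∀ᵐ x ∂ν, HasSum (fun i => F i x) (f x)) :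
    Integrable f ν ∧ HasSum (fun i => ∫ x, F i x ∂ν) (∫ x, f x ∂ν) := by
  have hm : AEStronglyMeasurable f ν := by
    refine aestronglyMeasurable_of_tendsto_ae (atTop : Filter (Finset ι))
      (f := fun s x => ∑ i ∈ s, F i x) (fun s => ?_) hf
    exact Finset.aestronglyMeasurable_fun_sum s fun i _ => (hF i).1
  refine ⟨⟨hm, ?_⟩, ?_⟩
  · have h1 : ∀ᵐ x ∂ν, ‖f x‖ₑ ≤ ∑' i, ‖F i x‖ₑ := by
      filter_upwards [hf] with x hx
      rw [← hx.tsum_eq]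
      exact enorm_tsum_le_tsum_enorm
    refine (lintegral_mono_ae h1).trans_lt ?_
    rw [lintegral_tsum fun i => (hF i).1.enorm]
    have h2 : ∀ i, ∫⁻ x, ‖F i x‖ₑ ∂ν = ENNReal.ofReal (∫ x, ‖F i x‖ ∂ν) := fun i => by
      rw [ofReal_integral_norm_eq_lintegral_enorm (hF i)]
    simp_rw [h2]
    exact hs.tsum_ofReal_lt_top
  · have h := hasSum_integral_of_summable_integral_norm hF hs
    rwa [integral_congr_ae (hf.mono fun x hx => hx.tsum_eq)] at h

/-- The moment `π^(-(m-1)/2) ∫ d^m q' δ^(2n) S^(-2(l+k+n))`, where `a = 2l - m/2`. -/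
noncomputable def momentWeight (l a q : ℝ) (j : ℕ × ℕ) : ℝ :=
  Real.Gamma (j.2 + 1 / 2) * Real.Gamma (a + (j.2 + 2 * j.1 : ℕ)) /
    Real.Gamma (2 * (l + j.1 + j.2)) * q ^ (2 * j.2) *
      (q ^ 2 / 4) ^ (-(a + (j.2 + 2 * j.1 : ℕ)))

theorem momentWeight_pos {l a q : ℝ} (hl : 0 < l) (ha : 0 < a) (hq : 0 < q) (j : ℕ × ℕ) :
    0 < momentWeight l a q j := by
  have h1 : 0 < Real.Gamma ((j.2 : ℝ) + 1 / 2) := Real.Gamma_pos_of_pos (by positivity)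
  have h2 : 0 < Real.Gamma (a + (j.2 + 2 * j.1 : ℕ)) := Real.Gamma_pos_of_pos (by positivity)
  have h3 : 0 < Real.Gamma (2 * (l + j.1 + j.2)) := Real.Gamma_pos_of_pos (by positivity)
  unfold momentWeight
  positivity

/-- Duplication splits the `Γ(2(l+k+n))` in the denominator into `(l)_(k+n)`, which cancels against
`massCoeff`, and `(b+1)_(k+n)`. Moreover `l - 1/2 = b`, and `Γ(n + 1/2)` supplies `(1/2)_n`. -/
theorem massCoeff_mul_momentWeight {D m p q : ℝ} (hD4 : D < 4) (ha : 0 < parA D m) (hq : 0 < q)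
    (j : ℕ × ℕ) :
    massCoeff ((4 - D) / 2) j.1 j.2 * (-(p ^ 2 / 4)) ^ j.1 *
        momentWeight ((4 - D) / 2) (parA D m) q j =
      √Real.pi * Real.Gamma (parA D m) / Real.Gamma (4 - D) * (q ^ 2 / 4) ^ (-parA D m) *
        doubleTerm D m (bigX p q) j.2 j.1 := by
  obtain ⟨k, n⟩ := j
  have hl : 0 < (4 - D) / 2 := by linarith
  have hb1 : 0 < parB D + 1 := by unfold parB; linarith
  have g1 : Real.Gamma ((n : ℝ) + 1 / 2) = poch (1 / 2) n * √Real.pi := by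
    rw [add_comm, Gamma_add_nat (by norm_num), Real.Gamma_one_half_eq]
  have g2 : Real.Gamma (2 * ((4 - D) / 2 + k + n)) =
      4 ^ (k + n) * (poch ((4 - D) / 2) (k + n) * poch (parB D + 1) (k + n)) *
        Real.Gamma (4 - D) := by
    rw [show 2 * ((4 - D) / 2 + k + n) = (4 - D) + (2 * (k + n) : ℕ) by push_cast; ring,
      Gamma_add_nat (by linarith), poch_two_mul,
      show (4 - D + 1) / 2 = parB D + 1 by unfold parB; ring]
  have hq2 : 0 < q ^ 2 / 4 := by positivity
  have e1 : (q ^ 2 / 4) ^ (-(parA D m + (n + 2 * k : ℕ))) =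
      (q ^ 2 / 4) ^ (-parA D m) / ((q ^ 2 / 4) ^ n * ((q ^ 2 / 4) ^ 2) ^ k) := by
    rw [neg_add, ← sub_eq_add_neg, Real.rpow_sub hq2, Real.rpow_natCast, pow_add, pow_mul]
  have g0 : Real.Gamma (4 - D) ≠ 0 := (Real.Gamma_pos_of_pos (by linarith)).ne'
  have p1 := (poch_pos hl (k + n)).ne'
  have p2 := (poch_pos hb1 (k + n)).ne'
  have p3 := (poch_pos (by norm_num : (0 : ℝ) < 3 / 2) (k + n)).ne'
  have hf : (n.factorial : ℝ) ≠ 0 := by positivity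
  rw [massCoeff, momentWeight, doubleTerm, e1, g1, g2, Gamma_add_nat ha, add_comm n k,
    show (4 - D) / 2 - 1 / 2 = parB D by unfold parB; ring, bigX]
  have e2 : (-(4 * p ^ 2 / q ^ 4) / 4) ^ k =
      (-(p ^ 2 / 4)) ^ k / ((q ^ 2 / 4) ^ 2) ^ k / 4 ^ k := by
    rw [← div_pow, ← div_pow]; congr 1; field_simp
  have e3 : q ^ (2 * n) = (q ^ 2 / 4) ^ n * 4 ^ n := by
    rw [← mul_pow, div_mul_cancel₀ _ (by norm_num), pow_mul]
  rw [e2, e3, pow_add (4 : ℝ)]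
  have h1 : (q ^ 2 / 4) ^ n ≠ 0 := by positivity
  have h2 : ((q ^ 2 / 4) ^ 2) ^ k ≠ 0 := by positivity
  generalize (q ^ 2 / 4) ^ n = Q1 at *
  generalize ((q ^ 2 / 4) ^ 2) ^ k = Q2 at *
  generalize (q ^ 2 / 4) ^ (-parA D m) = Q3 at *
  generalize (-(p ^ 2 / 4)) ^ k = P1 at *
  field_simp

/-- The overall constant. -/
theorem loop_constant {D m q : ℝ} (hD4 : D < 4) (hq : 0 < q) :
    1 / (2 * Real.pi) ^ m * (1 / (2 * Real.pi) ^ D * (Real.pi ^ (D / 2) *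
      Real.Gamma ((4 - D) / 2)) * (Real.pi ^ ((m - 1) / 2) *
      (√Real.pi * Real.Gamma (parA D m) / Real.Gamma (4 - D) * (q ^ 2 / 4) ^ (-parA D m)))) =
    coeffA D m * q ^ (-4 + 2 * eps D m) := by
  have hpi := Real.pi_pos
  have hg : 0 < Real.Gamma ((4 - D) / 2) := Real.Gamma_pos_of_pos (by linarith)
  have hg5 : 0 < Real.Gamma ((5 - D) / 2) := Real.Gamma_pos_of_pos (by linarith)
  have hdup : Real.Gamma (4 - D) =
      Real.Gamma ((4 - D) / 2) * Real.Gamma ((5 - D) / 2) / (2 ^ (D - 3) * √Real.pi) := by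
    have h := Real.Gamma_mul_Gamma_add_half ((4 - D) / 2)
    rw [show (4 - D) / 2 + 1 / 2 = (5 - D) / 2 by ring, show 2 * ((4 - D) / 2) = 4 - D by ring,
      show 1 - (4 - D) = D - 3 by ring] at h
    rw [h, mul_assoc, mul_div_assoc, div_self (by positivity), mul_one]
  have hA : Real.Gamma (2 - eps D m) = Real.Gamma (parA D m) := by
    congr 1; unfold eps parA; ring
  have hq4 : (q ^ 2 / 4) ^ (-parA D m) = q ^ (-4 + 2 * eps D m) * 2 ^ (2 * parA D m) := by
    rw [Real.div_rpow (by positivity) (by norm_num), ← Real.rpow_natCast q 2,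
      ← Real.rpow_mul hq.le, show (4 : ℝ) = 2 ^ (2 : ℝ) by norm_num, ← Real.rpow_mul two_pos.le,
      show (2 : ℝ) * -parA D m = -(2 * parA D m) by ring, Real.rpow_neg two_pos.le, div_inv_eq_mul]
    congr 2
    unfold parA eps; push_cast; norm_num; ring
  have h16 : (16 * Real.pi) ^ ((D + m - 1) / 2) =
      2 ^ (2 * (D + m - 1)) * Real.pi ^ ((D + m - 1) / 2) := by
    rw [Real.mul_rpow (by norm_num) hpi.le, show (16 : ℝ) = 2 ^ (4 : ℝ) by norm_num,
      ← Real.rpow_mul two_pos.le]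
    congr 2; ring
  have h2pi : ∀ t : ℝ, (2 * Real.pi) ^ t = 2 ^ t * Real.pi ^ t := fun t =>
    Real.mul_rpow two_pos.le hpi.le
  have hpow : (2 : ℝ) ^ (D - 3) * 2 ^ (2 * parA D m) * 2 ^ (2 * (D + m - 1)) =
      8 * (2 ^ m * 2 ^ D) := by
    rw [show (8 : ℝ) = 2 ^ (3 : ℝ) by norm_num, ← Real.rpow_add two_pos, ← Real.rpow_add two_pos,
      ← Real.rpow_add two_pos, ← Real.rpow_add two_pos]
    congr 1; unfold parA; ring
  have hpipow : Real.pi ^ (D / 2) * Real.pi ^ ((m - 1) / 2) * √Real.pi * √Real.pi *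
      Real.pi ^ ((D + m - 1) / 2) = Real.pi ^ m * Real.pi ^ D := by
    rw [Real.sqrt_eq_rpow, ← Real.rpow_add hpi, ← Real.rpow_add hpi, ← Real.rpow_add hpi,
      ← Real.rpow_add hpi, ← Real.rpow_add hpi]
    congr 1; ring
  rw [coeffA, hA, h16, h2pi, h2pi, hq4, hdup]
  have z1 : (2 : ℝ) ^ m ≠ 0 := by positivity
  have z2 : (2 : ℝ) ^ D ≠ 0 := by positivity
  have z3 : Real.pi ^ m ≠ 0 := by positivity
  have z4 : Real.pi ^ D ≠ 0 := by positivity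
  have z5 : (2 : ℝ) ^ (2 * (D + m - 1)) ≠ 0 := by positivity
  have z6 : Real.pi ^ ((D + m - 1) / 2) ≠ 0 := by positivity
  have z7 : (2 : ℝ) ^ (D - 3) ≠ 0 := by positivity
  have z8 : √Real.pi ≠ 0 := by positivity
  -- With all powers and Gamma values as atoms, what remains to be used is `hpow` for the powers of
  -- `2` and `hpipow` for those of `π`.
  generalize (2 : ℝ) ^ m = a1 at *
  generalize (2 : ℝ) ^ D = a2 at *
  generalize Real.pi ^ m = a3 at *
  generalize Real.pi ^ D = a4 at *
  generalize (2 : ℝ) ^ (2 * (D + m - 1)) = a5 at *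
  generalize Real.pi ^ ((D + m - 1) / 2) = a6 at *
  generalize (2 : ℝ) ^ (D - 3) = a7 at *
  generalize √Real.pi = a8 at *
  generalize (2 : ℝ) ^ (2 * parA D m) = a9 at *
  generalize Real.pi ^ (D / 2) = c1 at *
  generalize Real.pi ^ ((m - 1) / 2) = c2 at *
  generalize Real.Gamma ((4 - D) / 2) = G1 at *
  generalize Real.Gamma ((5 - D) / 2) = G2 at *
  generalize Real.Gamma (parA D m) = G3 at *
  generalize q ^ (-4 + 2 * eps D m) = b1 at *
  have hg' := hg.ne'
  have hg5' := hg5.ne'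
  field_simp
  linear_combination (G3 * b1 * c1 * c2 * a8 ^ 2 * a6) * hpow + (G3 * b1 * 8 * a1 * a2) * hpipow

/-! ### The outer integral in real dimension -/

/-- Derivative of `massTerm` with respect to `S`. -/
noncomputable def massTermDeriv (l p S δ : ℝ) (j : ℕ × ℕ) : ℝ :=
  massCoeff l j.1 j.2 * (-(p ^ 2 / 4)) ^ j.1 * δ ^ (2 * j.2) *
    (-(2 * (l + j.1 + j.2)) * S ^ (-(2 * (l + j.1 + j.2)) - 1))

theorem abs_massTermDeriv {l : ℝ} (hl : 0 < l) (p : ℝ) {S : ℝ} (hS : 0 < S) (δ : ℝ) (j : ℕ × ℕ) :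
    |massTermDeriv l p S δ j| = |massCoeff l j.1 j.2 * (-(p ^ 2 / 4)) ^ j.1 * δ ^ (2 * j.2)| *
      (2 * (l + j.1 + j.2) * S ^ (-(2 * (l + j.1 + j.2)) - 1)) := by
  rw [massTermDeriv, abs_mul, abs_mul (-(2 * _)), abs_neg,
    abs_of_pos (by positivity : 0 < 2 * (l + j.1 + j.2)), abs_of_pos (Real.rpow_pos_of_pos hS _)]

/-- Gives a bound uniform in `v` on a half-line, as termwise differentiation requires. -/
theorem abs_massTermDeriv_anti {l : ℝ} (hl : 0 < l) (p : ℝ) {S S' : ℝ} (hS : 0 < S) (hSS : S ≤ S')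
    (δ : ℝ) (j : ℕ × ℕ) : |massTermDeriv l p S' δ j| ≤ |massTermDeriv l p S δ j| := by
  rw [abs_massTermDeriv hl p hS, abs_massTermDeriv hl p (hS.trans_le hSS)]
  have : (0 : ℝ) ≤ 2 * (l + j.1 + j.2) := by positivity
  refine mul_le_mul_of_nonneg_left (mul_le_mul_of_nonneg_left ?_ this) (abs_nonneg _)
  exact Real.rpow_le_rpow_of_nonpos hS hSS (by linarith)

/-- The extra factor `N = 2(l+k+n)` from differentiation is absorbed by a slightly smaller `S'`:
since `N log(S/S') ≤ (S/S')^N`, the derivative term at `S` is a constant multiple of the term at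
`S'`. -/
theorem summable_abs_massTermDeriv {l : ℝ} (hl : 0 < l) (hl2 : l < 2) {p S S' δ : ℝ}
    (hδ : |δ| < S') (hp : p ^ 2 < 4 * S' ^ 2) (hS : S' < S) :
    Summable fun j => |massTermDeriv l p S δ j| := by
  have hS'0 : 0 < S' := (abs_nonneg δ).trans_lt hδ
  have hS0 : 0 < S := hS'0.trans hS
  have hlog : 0 < Real.log (S / S') := Real.log_pos ((one_lt_div hS'0).2 hS)
  refine Summable.of_nonneg_of_le (fun _ => abs_nonneg _) (fun j => ?_)
    ((summable_abs_massTerm hl hl2 hδ hp).mul_left (S⁻¹ / Real.log (S / S')))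
  set N : ℝ := 2 * (l + j.1 + j.2) with hN
  have hN0 : 0 < N := by positivity
  have hkey : N * S ^ (-N) ≤ (Real.log (S / S'))⁻¹ * S' ^ (-N) := by
    have h1 : N * Real.log (S / S') ≤ (S / S') ^ N := by
      rw [Real.rpow_def_of_pos (by positivity), mul_comm]
      linarith [Real.add_one_le_exp (Real.log (S / S') * N)]
    rw [Real.div_rpow hS0.le hS'0.le, le_div_iff₀ (by positivity)] at h1
    rw [Real.rpow_neg hS0.le, Real.rpow_neg hS'0.le, ← div_eq_mul_inv, ← mul_inv,
      div_le_iff₀ (by positivity), inv_mul_eq_div, le_div_iff₀ (by positivity)]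
    linarith
  rw [abs_massTermDeriv hl p hS0, massTerm, abs_mul (_ * _ * _) (S' ^ _),
    abs_of_pos (Real.rpow_pos_of_pos hS'0 _), ← hN, Real.rpow_sub_one hS0.ne']
  calc |massCoeff l j.1 j.2 * (-(p ^ 2 / 4)) ^ j.1 * δ ^ (2 * j.2)| * (N * (S ^ (-N) / S))
      = |massCoeff l j.1 j.2 * (-(p ^ 2 / 4)) ^ j.1 * δ ^ (2 * j.2)| * S⁻¹ * (N * S ^ (-N)) := by
        ring
    _ ≤ |massCoeff l j.1 j.2 * (-(p ^ 2 / 4)) ^ j.1 * δ ^ (2 * j.2)| * S⁻¹ *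
        ((Real.log (S / S'))⁻¹ * S' ^ (-N)) := by gcongr
    _ = _ := by ring

theorem half_sum_masses (q y v : ℝ) :
    ((y ^ 2 + v) + ((y + q) ^ 2 + v)) / 2 = (y + q / 2) ^ 2 + v + q ^ 2 / 4 := by ring

/-- The half difference does not involve `v`, so differentiation in `v` acts on powers of `S` alone.
-/
theorem half_diff_masses (q y v : ℝ) :
    ((y ^ 2 + v) - ((y + q) ^ 2 + v)) / 2 = -(q * (y + q / 2)) := by ring

theorem abs_half_diff_lt (q y : ℝ) {v : ℝ} (hv : 0 < v) :
    |-(q * (y + q / 2))| < (y + q / 2) ^ 2 + v + q ^ 2 / 4 := by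
  rw [abs_lt]
  constructor <;> nlinarith [sq_nonneg (y + q / 2 - q / 2), sq_nonneg (y + q / 2 + q / 2)]

/-- `X < 1` means `p² < q⁴/4 = 4 (q²/4)²`, and `q²/4` is the least possible value of `S`. -/
theorem sq_lt_of_bigX_lt_one {p q : ℝ} (hq : 0 < q) (hX : bigX p q < 1) {S : ℝ}
    (hS : q ^ 2 / 4 ≤ S) : p ^ 2 < 4 * S ^ 2 := by
  rw [bigX, div_lt_one (by positivity)] at hX
  have : (q ^ 2 / 4) ^ 2 ≤ S ^ 2 := pow_le_pow_left₀ (by positivity) hS 2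
  nlinarith

section Outer

variable {D m p q : ℝ}

theorem outerIntegrand_eq (hD : 0 < D) (hD4 : D < 4) (p q y : ℝ) {v : ℝ} (hv : 0 < v) :
    outerIntegrand D p q y v = 1 / (2 * Real.pi) ^ D * (Real.pi ^ (D / 2) *
      Real.Gamma ((4 - D) / 2)) * massIntegral ((4 - D) / 2) p (y ^ 2 + v) ((y + q) ^ 2 + v) := by
  rw [outerIntegrand, innerIntegral, dimIntegral_innerIntegrand hD hD4 p (by positivity)
    (by positivity)]
  ring

theorem hasSum_massTerm_outer (hD : 0 < D) (hD4 : D < 4) (hq : 0 < q) (hX : bigX p q < 1)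
    (y : ℝ) {v : ℝ} (hv : 0 < v) :
    HasSum (massTerm ((4 - D) / 2) p ((y + q / 2) ^ 2 + v + q ^ 2 / 4) (-(q * (y + q / 2))))
      (massIntegral ((4 - D) / 2) p (y ^ 2 + v) ((y + q) ^ 2 + v)) := by
  have h := hasSum_massTerm (l := (4 - D) / 2) (p := p) (κ₁ := y ^ 2 + v) (κ₂ := (y + q) ^ 2 + v)
    (by linarith) (by linarith) (by positivity) (by positivity) ?_
  · rwa [half_sum_masses, half_diff_masses] at h
  · have := sq_lt_of_bigX_lt_one hq hX (S := (y + q / 2) ^ 2 + v + q ^ 2 / 4)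
      (by nlinarith [sq_nonneg (y + q / 2)])
    rw [← half_sum_masses] at this
    linarith

theorem hasDerivAt_massIntegral_outer (hD : 0 < D) (hD4 : D < 4) (hq : 0 < q) (hX : bigX p q < 1)
    (y : ℝ) {v : ℝ} (hv : 0 < v) :
    HasDerivAt (fun v => massIntegral ((4 - D) / 2) p (y ^ 2 + v) ((y + q) ^ 2 + v))
      (∑' j, massTermDeriv ((4 - D) / 2) p ((y + q / 2) ^ 2 + v + q ^ 2 / 4)
        (-(q * (y + q / 2))) j) v := by
  have hl : 0 < (4 - D) / 2 := by linarith
  have hl2 : (4 - D) / 2 < 2 := by linarith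
  have hSpos : ∀ w : ℝ, 0 < w → 0 < (y + q / 2) ^ 2 + w + q ^ 2 / 4 := fun w hw => by positivity
  -- On `w > v/2` the derivative terms are dominated by those at `v/2`, whose sum converges by
  -- comparison with the undifferentiated series at `v/4`.
  have h := hasDerivAt_tsum_of_isPreconnected (𝕜 := ℝ)
    (g := fun j w => massTerm ((4 - D) / 2) p ((y + q / 2) ^ 2 + w + q ^ 2 / 4)
      (-(q * (y + q / 2))) j)
    (g' := fun j w => massTermDeriv ((4 - D) / 2) p ((y + q / 2) ^ 2 + w + q ^ 2 / 4)
      (-(q * (y + q / 2))) j) (t := Ioi (v / 2)) (y₀ := v) (y := v)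
    (summable_abs_massTermDeriv hl hl2 (p := p) (S := (y + q / 2) ^ 2 + v / 2 + q ^ 2 / 4)
      (S' := (y + q / 2) ^ 2 + v / 4 + q ^ 2 / 4) (δ := -(q * (y + q / 2)))
      (abs_half_diff_lt q y (by linarith)) (sq_lt_of_bigX_lt_one hq hX
        (by nlinarith [sq_nonneg (y + q / 2)])) (by linarith))
    isOpen_Ioi isPreconnected_Ioi ?_ ?_ (by simp [hv]) ?_ (by simp [hv])
  · refine h.congr_of_eventuallyEq ?_
    filter_upwards [Ioi_mem_nhds hv] with w hw
    exact (hasSum_massTerm_outer hD hD4 hq hX y hw).tsum_eq.symm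
  · intro j w hw
    have hw0 : 0 < w := by
      have : v / 2 < w := hw
      linarith
    have d1 : HasDerivAt (fun w => (y + q / 2) ^ 2 + w + q ^ 2 / 4) 1 w :=
      ((hasDerivAt_id w).const_add _).add_const _
    have := (d1.rpow_const (p := -(2 * ((4 - D) / 2 + j.1 + j.2))) (Or.inl (hSpos w hw0).ne')).const_mul
      (massCoeff ((4 - D) / 2) j.1 j.2 * (-(p ^ 2 / 4)) ^ j.1 * (-(q * (y + q / 2))) ^ (2 * j.2))
    convert! this using 1
    rw [massTermDeriv, one_mul]
  · intro j w hw
    have hw' : v / 2 < w := hw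
    exact abs_massTermDeriv_anti hl p (hSpos _ (by linarith)) (by linarith) _ j
  · exact (hasSum_massTerm_outer hD hD4 hq hX y hv).summable

theorem hasSum_deriv_massIntegral_outer (hD : 0 < D) (hD4 : D < 4) (hq : 0 < q)
    (hX : bigX p q < 1) (y : ℝ) {v : ℝ} (hv : 0 < v) :
    HasSum (massTermDeriv ((4 - D) / 2) p ((y + q / 2) ^ 2 + v + q ^ 2 / 4) (-(q * (y + q / 2))))
      (deriv (fun v => massIntegral ((4 - D) / 2) p (y ^ 2 + v) ((y + q) ^ 2 + v)) v) := by
  rw [(hasDerivAt_massIntegral_outer hD hD4 hq hX y hv).deriv]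
  exact (summable_abs_massTermDeriv (by linarith) (by linarith)
    (S' := (y + q / 2) ^ 2 + v / 2 + q ^ 2 / 4)
    (abs_half_diff_lt q y (by linarith)) (sq_lt_of_bigX_lt_one hq hX
        (by nlinarith [sq_nonneg (y + q / 2)])) (by linarith)).of_abs.hasSum

/-- A Beta integral in `v`, then a moment in the shifted variable `y + q/2`. The factor `2(l+k+n)`
from the derivative cancels against `Γ(N+1) = N Γ(N)`, so the result is the moment of the
undifferentiated term. -/
theorem lintegral_outer_moment (hm : 0 < m) {l : ℝ} (hl : 0 < l) (ha : 0 < 2 * l - m / 2)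
    (hq : 0 < q) (j : ℕ × ℕ) :
    ∫⁻ y : ℝ, ∫⁻ v in Ioi (0 : ℝ), ENNReal.ofReal (v ^ ((m - 1) / 2) *
      ((-(q * (y + q / 2))) ^ (2 * j.2) * (2 * (l + j.1 + j.2) *
        ((y + q / 2) ^ 2 + v + q ^ 2 / 4) ^ (-(2 * (l + j.1 + j.2)) - 1)))) =
    ENNReal.ofReal (Real.Gamma ((m + 1) / 2) * momentWeight l (2 * l - m / 2) q j) := by
  obtain ⟨k, n⟩ := j
  simp only
  have hk : (0 : ℝ) ≤ k := k.cast_nonneg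
  have hn : (0 : ℝ) ≤ n := n.cast_nonneg
  set N : ℝ := 2 * (l + k + n) with hN
  have hN0 : 0 < N := by positivity
  have hg1 : 0 < Real.Gamma ((m + 1) / 2) := Real.Gamma_pos_of_pos (by linarith)
  have hgN : 0 < Real.Gamma N := Real.Gamma_pos_of_pos hN0
  have hgN' : 0 < Real.Gamma (N - (m - 1) / 2) := Real.Gamma_pos_of_pos (by rw [hN]; linarith)
  have hq2 : 0 < q ^ 2 / 4 := by positivity
  have hΓ : Real.Gamma (N + 1) = N * Real.Gamma N := Real.Gamma_add_one hN0.ne'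
  calc _ = ∫⁻ y : ℝ, ENNReal.ofReal (q ^ (2 * n) * (Real.Gamma ((m + 1) / 2) *
        Real.Gamma (N - (m - 1) / 2) / Real.Gamma N)) * ENNReal.ofReal
          ((y + q / 2) ^ (2 * n) * ((y + q / 2) ^ 2 + q ^ 2 / 4) ^ (-(N - (m - 1) / 2))) := by
        refine lintegral_congr fun y => ?_
        have hE : (0 : ℝ) ≤ (-(q * (y + q / 2))) ^ (2 * n) := (even_two_mul n).pow_nonneg _
        have h := lintegral_rpow_mul_add_rpow (s := (m + 1) / 2) (N := N + 1)
          (C := (y + q / 2) ^ 2 + q ^ 2 / 4) (by linarith) (by rw [hN]; linarith) (by positivity)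
        rw [show (m + 1) / 2 - 1 = (m - 1) / 2 by ring,
          show N + 1 - (m + 1) / 2 = N - (m - 1) / 2 by ring,
          show (m + 1) / 2 - (N + 1) = -(N - (m - 1) / 2) by ring] at h
        have e : ∀ v : ℝ, ENNReal.ofReal (v ^ ((m - 1) / 2) *
            ((-(q * (y + q / 2))) ^ (2 * n) *
              (N * ((y + q / 2) ^ 2 + v + q ^ 2 / 4) ^ (-N - 1)))) =
            ENNReal.ofReal ((-(q * (y + q / 2))) ^ (2 * n) * N) * ENNReal.ofReal
              (v ^ ((m - 1) / 2) * (v + ((y + q / 2) ^ 2 + q ^ 2 / 4)) ^ (-(N + 1))) := by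
          intro v
          rw [← ENNReal.ofReal_mul (by positivity)]
          congr 1
          rw [show (y + q / 2) ^ 2 + v + q ^ 2 / 4 = v + ((y + q / 2) ^ 2 + q ^ 2 / 4) by ring,
            neg_add']
          ring
        simp only [e]
        rw [lintegral_const_mul _ (by fun_prop), h, ← ENNReal.ofReal_mul (by positivity),
          ← ENNReal.ofReal_mul (by positivity), hΓ, (even_two_mul n).neg_pow, mul_pow]
        congr 1
        field_simp
    _ = _ := by
        have h := lintegral_pow_mul_sq_add_rpow n (N := N - (m - 1) / 2) (C := q ^ 2 / 4)
          (by rw [hN]; linarith) hq2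
        rw [lintegral_const_mul _ (by fun_prop), lintegral_add_right_eq_self
          (fun y => ENNReal.ofReal (y ^ (2 * n) * (y ^ 2 + q ^ 2 / 4) ^ (-(N - (m - 1) / 2)))), h,
          ← ENNReal.ofReal_mul (by positivity), momentWeight]
        have e1 : N - (m - 1) / 2 - (n + 1 / 2) = 2 * l - m / 2 + (n + 2 * k : ℕ) := by
          rw [hN]; push_cast; ring
        have e2 : n + 1 / 2 - (N - (m - 1) / 2) = -(2 * l - m / 2 + (n + 2 * k : ℕ)) := by
          rw [← e1]; ring
        rw [e1, e2, ← hN]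
        generalize 2 * l - m / 2 + ((n + 2 * k : ℕ) : ℝ) = A
        generalize Real.Gamma (N - (m - 1) / 2) = G at *
        congr 1
        field_simp

theorem parA_eq (D m : ℝ) : parA D m = 2 * ((4 - D) / 2) - m / 2 := by unfold parA; ring

/-- The prefactor of the inner integral. -/
noncomputable def innerConst (D : ℝ) : ℝ :=
  1 / (2 * Real.pi) ^ D * (Real.pi ^ (D / 2) * Real.Gamma ((4 - D) / 2))

theorem hasDerivAt_outerIntegrand (hD : 0 < D) (hD4 : D < 4) (hq : 0 < q) (hX : bigX p q < 1)
    (y : ℝ) {v : ℝ} (hv : 0 < v) :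
    HasDerivAt (outerIntegrand D p q y) (innerConst D *
      deriv (fun v => massIntegral ((4 - D) / 2) p (y ^ 2 + v) ((y + q) ^ 2 + v)) v) v := by
  have h := (hasDerivAt_massIntegral_outer hD hD4 hq hX y hv).differentiableAt.hasDerivAt.const_mul
    (innerConst D)
  refine h.congr_of_eventuallyEq ?_
  filter_upwards [Ioi_mem_nhds hv] with w hw
  exact outerIntegrand_eq hD hD4 p q y hw

/-- Both masses are at least `v` and the `p²` term is nonnegative; this gives the decay as `v → ∞`.
-/
theorem massIntegral_le {l : ℝ} (hl : 0 < l) (p y q : ℝ) {v : ℝ} (hv : 0 < v) :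
    massIntegral l p (y ^ 2 + v) ((y + q) ^ 2 + v) ≤ (v ^ 2) ^ (-l) := by
  have h1 : 0 < y ^ 2 + v := by positivity
  have h2 : 0 < (y + q) ^ 2 + v := by positivity
  have hc : ContinuousOn (fun s => feynmanMass p (y ^ 2 + v) ((y + q) ^ 2 + v) s ^ (-l))
      (Icc 0 1) :=
    (continuous_feynmanMass p _ _).continuousOn.rpow_const fun s hs =>
      Or.inl (feynmanMass_pos p h1 h2 hs).ne'
  have hi : IntervalIntegrable (fun s => feynmanMass p (y ^ 2 + v) ((y + q) ^ 2 + v) s ^ (-l))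
      volume 0 1 := by
    refine ContinuousOn.intervalIntegrable ?_
    rwa [uIcc_of_le zero_le_one]
  calc massIntegral l p (y ^ 2 + v) ((y + q) ^ 2 + v)
      ≤ ∫ _ in (0 : ℝ)..1, (v ^ 2) ^ (-l) := by
        refine intervalIntegral.integral_mono_on zero_le_one hi intervalIntegrable_const
          fun s hs => ?_
        refine Real.rpow_le_rpow_of_nonpos (by positivity) ?_ (by linarith)
        have e1 : v ^ 2 ≤ (y ^ 2 + v) ^ 2 := pow_le_pow_left₀ hv.le (by nlinarith) 2
        have e2 : v ^ 2 ≤ ((y + q) ^ 2 + v) ^ 2 :=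
          pow_le_pow_left₀ hv.le (by nlinarith [sq_nonneg (y + q)]) 2
        have := mul_nonneg (mul_nonneg hs.1 (sub_nonneg.2 hs.2)) (sq_nonneg p)
        nlinarith [mul_le_mul_of_nonneg_left e1 hs.1,
          mul_le_mul_of_nonneg_left e2 (sub_nonneg.2 hs.2)]
    _ = _ := by simp

theorem tendsto_outerIntegrand (hD : 0 < D) (hD4 : D < 4) (p q y : ℝ) :
    Tendsto (outerIntegrand D p q y) atTop (𝓝 0) := by
  have hl : 0 < (4 - D) / 2 := by linarith
  have h1 : Tendsto (fun v : ℝ => (v ^ 2) ^ (-((4 - D) / 2))) atTop (𝓝 0) :=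
    (tendsto_rpow_neg_atTop hl).comp (tendsto_pow_atTop two_ne_zero)
  have h2 : Tendsto (fun v => massIntegral ((4 - D) / 2) p (y ^ 2 + v) ((y + q) ^ 2 + v)) atTop
      (𝓝 0) := by
    refine tendsto_of_tendsto_of_tendsto_of_le_of_le' tendsto_const_nhds h1 ?_ ?_
    · filter_upwards [eventually_gt_atTop 0] with v hv
      exact massIntegral_nonneg _ p (by positivity) (by positivity)
    · filter_upwards [eventually_gt_atTop 0] with v hv
      exact massIntegral_le hl p y q hv
  have h3 := h2.const_mul (innerConst D)
  rw [mul_zero] at h3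
  refine h3.congr' ?_
  filter_upwards [eventually_gt_atTop 0] with v hv
  exact (outerIntegrand_eq hD hD4 p q y hv).symm

/-- The `(k, n)` term of the integrand of `dimIntegral m (outerIntegrand D p q)`. -/
noncomputable def outerTerm (D m p q : ℝ) (j : ℕ × ℕ) (z : ℝ × ℝ) : ℝ :=
  -(z.2 ^ ((m - 1) / 2) * (innerConst D * massTermDeriv ((4 - D) / 2) p
    ((z.1 + q / 2) ^ 2 + z.2 + q ^ 2 / 4) (-(q * (z.1 + q / 2))) j))

theorem integrable_and_integral_outer_moment (hD4 : D < 4) (hm : 0 < m) (ha : 0 < parA D m)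
    (hq : 0 < q) (j : ℕ × ℕ) :
    Integrable (fun z : ℝ × ℝ => z.2 ^ ((m - 1) / 2) *
      ((-(q * (z.1 + q / 2))) ^ (2 * j.2) * (2 * ((4 - D) / 2 + j.1 + j.2) *
        ((z.1 + q / 2) ^ 2 + z.2 + q ^ 2 / 4) ^ (-(2 * ((4 - D) / 2 + j.1 + j.2)) - 1))))
      ((volume : Measure ℝ).prod (volume.restrict (Ioi (0 : ℝ)))) ∧
    ∫ z : ℝ × ℝ, z.2 ^ ((m - 1) / 2) *
      ((-(q * (z.1 + q / 2))) ^ (2 * j.2) * (2 * ((4 - D) / 2 + j.1 + j.2) *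
        ((z.1 + q / 2) ^ 2 + z.2 + q ^ 2 / 4) ^ (-(2 * ((4 - D) / 2 + j.1 + j.2)) - 1)))
      ∂((volume : Measure ℝ).prod (volume.restrict (Ioi (0 : ℝ)))) =
      Real.Gamma ((m + 1) / 2) * momentWeight ((4 - D) / 2) (parA D m) q j := by
  have hl : 0 < (4 - D) / 2 := by linarith
  have hg : 0 < Real.Gamma ((m + 1) / 2) := Real.Gamma_pos_of_pos (by linarith)
  have hw := momentWeight_pos hl ha hq j
  refine integrable_and_integral_eq_of_lintegral ?_ ?_ (by positivity) ?_
  · refine Measurable.aestronglyMeasurable ?_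
    fun_prop
  · filter_upwards [ae_snd_pos] with z hz
    have h1 := Real.rpow_nonneg hz.le ((m - 1) / 2)
    have h2 : 0 ≤ (-(q * (z.1 + q / 2))) ^ (2 * j.2) := (even_two_mul _).pow_nonneg _
    simp only [Pi.zero_apply]
    positivity
  · rw [lintegral_prod _ (by fun_prop), lintegral_outer_moment hm hl (by rwa [← parA_eq]) hq,
      parA_eq]

theorem outerTerm_eq (D m p q : ℝ) (j : ℕ × ℕ) : outerTerm D m p q j =
    fun z : ℝ × ℝ => innerConst D * (massCoeff ((4 - D) / 2) j.1 j.2 * (-(p ^ 2 / 4)) ^ j.1) *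
      (z.2 ^ ((m - 1) / 2) *
      ((-(q * (z.1 + q / 2))) ^ (2 * j.2) * (2 * ((4 - D) / 2 + j.1 + j.2) *
        ((z.1 + q / 2) ^ 2 + z.2 + q ^ 2 / 4) ^ (-(2 * ((4 - D) / 2 + j.1 + j.2)) - 1)))) := by
  ext z
  rw [outerTerm, massTermDeriv]
  ring

theorem integrable_outerTerm (hD4 : D < 4) (hm : 0 < m) (ha : 0 < parA D m) (hq : 0 < q)
    (j : ℕ × ℕ) : Integrable (outerTerm D m p q j)
      ((volume : Measure ℝ).prod (volume.restrict (Ioi (0 : ℝ)))) := by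
  rw [outerTerm_eq]
  exact (integrable_and_integral_outer_moment hD4 hm ha hq j).1.const_mul _

/-- The prefactor of the double series, up to powers of `2π`. -/
noncomputable def seriesConst (D m q : ℝ) : ℝ :=
  √Real.pi * Real.Gamma (parA D m) / Real.Gamma (4 - D) * (q ^ 2 / 4) ^ (-parA D m)

theorem integral_outerTerm (hD4 : D < 4) (hm : 0 < m) (ha : 0 < parA D m) (hq : 0 < q)
    (j : ℕ × ℕ) : ∫ z, outerTerm D m p q j z
      ∂((volume : Measure ℝ).prod (volume.restrict (Ioi (0 : ℝ)))) =
      innerConst D * (Real.Gamma ((m + 1) / 2) * (seriesConst D m q *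
        doubleTerm D m (bigX p q) j.2 j.1)) := by
  rw [outerTerm_eq, integral_const_mul, (integrable_and_integral_outer_moment hD4 hm ha hq j).2,
    seriesConst, ← massCoeff_mul_momentWeight hD4 ha hq]
  ring

/-- The integrand is a constant times a nonnegative function because `δ` occurs to an even power, so
the `L¹` norm is the absolute value of the integral and nothing is lost in the estimate. -/
theorem integral_norm_outerTerm (hD4 : D < 4) (hm : 0 < m) (ha : 0 < parA D m) (hq : 0 < q)
    (j : ℕ × ℕ) : ∫ z, ‖outerTerm D m p q j z‖
      ∂((volume : Measure ℝ).prod (volume.restrict (Ioi (0 : ℝ)))) =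
      |innerConst D * (Real.Gamma ((m + 1) / 2) * (seriesConst D m q *
        doubleTerm D m (bigX p q) j.2 j.1))| := by
  have hl : 0 < (4 - D) / 2 := by linarith
  rw [← integral_outerTerm hD4 hm ha hq, outerTerm_eq, integral_const_mul, abs_mul,
    abs_of_nonneg (a := ∫ z, _ ∂_), ← integral_const_mul]
  · refine integral_congr_ae ?_
    filter_upwards [ae_snd_pos] with z hz
    have h1 := Real.rpow_nonneg hz.le ((m - 1) / 2)
    have h2 : 0 ≤ (-(q * (z.1 + q / 2))) ^ (2 * j.2) := (even_two_mul _).pow_nonneg _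
    rw [Real.norm_eq_abs, abs_mul]
    congr 1
    exact abs_of_nonneg (by positivity)
  · rw [(integrable_and_integral_outer_moment hD4 hm ha hq j).2]
    have hg : 0 < Real.Gamma ((m + 1) / 2) := Real.Gamma_pos_of_pos (by linarith)
    have hw := momentWeight_pos hl ha hq j
    positivity

theorem bigX_nonneg (p q : ℝ) : 0 ≤ bigX p q := by unfold bigX; positivity

theorem summable_abs_doubleTerm_swap (hD : 0 < D) (hD4 : D < 4) (hm : 0 < m) (ha : 0 < parA D m)
    (ha2 : parA D m < 2) (hX : bigX p q < 1) :
    Summable fun j : ℕ × ℕ => |doubleTerm D m (bigX p q) j.2 j.1| :=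
  (Equiv.prodComm ℕ ℕ).summable_iff.2
    (summable_abs_doubleTerm hD hD4 hm ha ha2 (bigX_nonneg p q) hX)

theorem outer_integrable_and_hasSum (hD : 0 < D) (hD4 : D < 4) (hm : 0 < m) (ha : 0 < parA D m)
    (ha2 : parA D m < 2) (hq : 0 < q) (hX : bigX p q < 1) :
    Integrable (fun z : ℝ × ℝ => -(z.2 ^ ((m - 1) / 2) * deriv (outerIntegrand D p q z.1) z.2))
      ((volume : Measure ℝ).prod (volume.restrict (Ioi (0 : ℝ)))) ∧
    HasSum (fun j : ℕ × ℕ => innerConst D * (Real.Gamma ((m + 1) / 2) * (seriesConst D m q *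
        doubleTerm D m (bigX p q) j.2 j.1)))
      (∫ z : ℝ × ℝ, -(z.2 ^ ((m - 1) / 2) * deriv (outerIntegrand D p q z.1) z.2)
        ∂((volume : Measure ℝ).prod (volume.restrict (Ioi (0 : ℝ))))) := by
  have h := integrable_and_hasSum_integral (F := outerTerm D m p q)
    (f := fun z : ℝ × ℝ => -(z.2 ^ ((m - 1) / 2) * deriv (outerIntegrand D p q z.1) z.2))
    (ν := (volume : Measure ℝ).prod (volume.restrict (Ioi (0 : ℝ))))
    (integrable_outerTerm hD4 hm ha hq) ?_ ?_
  · simp_rw [integral_outerTerm hD4 hm ha hq] at h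
    exact h
  · simp_rw [integral_norm_outerTerm hD4 hm ha hq, abs_mul]
    exact (((summable_abs_doubleTerm_swap hD hD4 hm ha ha2 hX).mul_left _).mul_left _).mul_left _
  · filter_upwards [ae_snd_pos] with z hz
    rw [(hasDerivAt_outerIntegrand hD hD4 hq hX z.1 hz).deriv]
    exact (((hasSum_deriv_massIntegral_outer hD hD4 hq hX z.1 hz).mul_left _).mul_left _).neg

theorem loopConvergent (hD : 0 < D) (hD4 : D < 4) (hm : 0 < m) (ha : 0 < parA D m)
    (ha2 : parA D m < 2) (hq : 0 < q) (hX : bigX p q < 1) : LoopConvergent D m p q := by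
  refine ⟨fun y v hv => dimIntegrable_innerIntegrand hD hD4 p (by positivity) (by positivity),
    ae_of_all _ fun y v hv => (hasDerivAt_outerIntegrand hD hD4 hq hX y hv).differentiableAt,
    ae_of_all _ fun y => tendsto_outerIntegrand hD hD4 p q y, ?_⟩
  simpa using (outer_integrable_and_hasSum hD hD4 hm ha ha2 hq hX).1.neg

theorem tsum_doubleTerm_swap (hD : 0 < D) (hD4 : D < 4) (hm : 0 < m) (ha : 0 < parA D m)
    (ha2 : parA D m < 2) (hX : bigX p q < 1) :
    ∑' j : ℕ × ℕ, doubleTerm D m (bigX p q) j.2 j.1 = ∑' n : ℕ, coeffB D m n *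
        hyp32 1 ((parA D m + n) / 2) ((parA D m + n + 1) / 2)
          (3 / 2 + n) (parB D + 1 + n) (-bigX p q) := by
  rw [(hasSum_doubleTerm hD hD4 hm ha ha2 (bigX_nonneg p q) hX).tsum_eq]
  exact (Equiv.prodComm ℕ ℕ).tsum_eq fun z : ℕ × ℕ => doubleTerm D m (bigX p q) z.1 z.2

theorem loopIntegral_eq (hD : 0 < D) (hD4 : D < 4) (hm : 0 < m) (ha : 0 < parA D m)
    (ha2 : parA D m < 2) (hq : 0 < q) (hX : bigX p q < 1) :
    loopIntegral D m p q = coeffA D m * q ^ (-4 + 2 * eps D m) *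
      ∑' n : ℕ, coeffB D m n *
        hyp32 1 ((parA D m + n) / 2) ((parA D m + n + 1) / 2)
          (3 / 2 + n) (parB D + 1 + n) (-bigX p q) := by
  have hg : 0 < Real.Gamma ((m + 1) / 2) := Real.Gamma_pos_of_pos (by linarith)
  rw [loopIntegral, dimIntegral_eq_integral_prod (loopConvergent hD hD4 hm ha ha2 hq hX).2,
    ← (outer_integrable_and_hasSum hD hD4 hm ha ha2 hq hX).2.tsum_eq, tsum_mul_left,
    tsum_mul_left, tsum_mul_left, tsum_doubleTerm_swap hD hD4 hm ha ha2 hX,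
    ← loop_constant hD4 hq, innerConst, seriesConst]
  field_simp

end Outer

/-! ### Integer dimensions -/

/-- An orthonormal basis with first vector along `q` makes Gaussian moments factor over coordinates.
For `q = 0` any basis serves. -/
theorem exists_orthonormalBasis_repr_zero {M : ℕ} (q : EuclideanSpace ℝ (Fin (M + 1))) :
    ∃ b : OrthonormalBasis (Fin (M + 1)) ℝ (EuclideanSpace ℝ (Fin (M + 1))),
      ∀ x, inner ℝ x q = ‖q‖ * b.repr x 0 := by
  by_cases hq : q = 0
  · exact ⟨EuclideanSpace.basisFun _ ℝ, fun x => by simp [hq]⟩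
  -- The family `q, 0, …, 0` is already orthogonal, so Gram–Schmidt only normalizes `q` and
  -- completes it to a basis.
  · set f : Fin (M + 1) → EuclideanSpace ℝ (Fin (M + 1)) := Pi.single 0 q with hf
    have hcard : Module.finrank ℝ (EuclideanSpace ℝ (Fin (M + 1))) = Fintype.card (Fin (M + 1)) := by
      simp
    have hort : Pairwise fun i j => inner ℝ (f i) (f j) = 0 := by
      intro i j hij
      by_cases hi : i = 0
      · have hj : j ≠ 0 := fun h => hij (hi.trans h.symm)
        simp [hf, hj]
      · simp [hf, hi]
    have h0 : InnerProductSpace.gramSchmidtOrthonormalBasis hcard f 0 = ‖q‖⁻¹ • q := by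
      rw [InnerProductSpace.gramSchmidtOrthonormalBasis_apply_of_orthogonal hcard hort
        (by simpa [hf] using hq)]
      simp [hf]
    refine ⟨InnerProductSpace.gramSchmidtOrthonormalBasis hcard f, fun x => ?_⟩
    have hq' : ‖q‖ ≠ 0 := norm_ne_zero_iff.2 hq
    rw [OrthonormalBasis.repr_apply_apply, h0, real_inner_smul_left, real_inner_comm q x]
    field_simp

theorem lintegral_euclidean_gaussian_moment {M : ℕ} (hM : 0 < M) (q : EuclideanSpace ℝ (Fin M))
    (n : ℕ) {t : ℝ} (ht : 0 < t) :
    ∫⁻ x : EuclideanSpace ℝ (Fin M),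
        ENNReal.ofReal ((inner ℝ x q) ^ (2 * n) * Real.exp (-(t * ‖x‖ ^ 2))) =
      ENNReal.ofReal (‖q‖ ^ (2 * n) * Real.pi ^ (((M : ℝ) - 1) / 2) * Real.Gamma (n + 1 / 2) *
        t ^ (-((n : ℝ) + M / 2))) := by
  obtain ⟨M, rfl⟩ : ∃ K, M = K + 1 := ⟨M - 1, by omega⟩
  obtain ⟨b, hb⟩ := exists_orthonormalBasis_repr_zero q
  -- The monomial has exponent `2n` along `q` and `0` in the other directions.
  set ν : Fin (M + 1) → ℕ := Pi.single 0 n with hν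
  set g : Fin (M + 1) → ℝ → ℝ := fun i y => y ^ (2 * ν i) * Real.exp (-(t * y ^ 2)) with hg
  have hgi : ∀ i, Integrable (g i) := fun i =>
    (integrable_and_integral_pow_mul_exp_neg_sq (ν i) ht).1
  have hgv : ∀ i, ∫ y, g i y = Real.Gamma (ν i + 1 / 2) * t ^ (-((ν i : ℝ) + 1 / 2)) := fun i =>
    (integrable_and_integral_pow_mul_exp_neg_sq (ν i) ht).2
  have hprod : ∀ x : EuclideanSpace ℝ (Fin (M + 1)),
      (inner ℝ x q) ^ (2 * n) * Real.exp (-(t * ‖x‖ ^ 2)) =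
        ‖q‖ ^ (2 * n) * ∏ i, g i (b.repr x i) := by
    intro x
    have h1 : ∏ i, g i (b.repr x i) = (b.repr x 0) ^ (2 * n) * Real.exp (-(t * ‖x‖ ^ 2)) := by
      simp only [hg]
      rw [Finset.prod_mul_distrib, ← Real.exp_sum]
      congr 1
      · rw [Fin.prod_univ_succ]
        simp [hν]
      · congr 1
        rw [Finset.sum_neg_distrib, ← Finset.mul_sum, ← b.repr.norm_map x, EuclideanSpace.norm_sq_eq]
        simp
    rw [h1, hb, mul_pow]; ring
  have hval : ∏ i, ∫ y, g i y =
      Real.pi ^ (((M + 1 : ℕ) - 1 : ℝ) / 2) * Real.Gamma (n + 1 / 2) *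
        t ^ (-((n : ℝ) + (M + 1 : ℕ) / 2)) := by
    simp only [hgv]
    rw [Fin.prod_univ_succ]
    simp only [hν, Pi.single_eq_same, Pi.single_eq_of_ne (Fin.succ_ne_zero _), Nat.cast_zero,
      zero_add, Real.Gamma_one_half_eq, Finset.prod_const, Finset.card_univ, Fintype.card_fin]
    rw [mul_pow, Real.sqrt_eq_rpow, ← Real.rpow_mul_natCast Real.pi_pos.le,
      ← Real.rpow_mul_natCast ht.le,
      show -((n : ℝ) + (M + 1 : ℕ) / 2) = -(n + 1 / 2) + -(1 / 2) * M by push_cast; ring,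
      Real.rpow_add ht, show ((M + 1 : ℕ) - 1 : ℝ) / 2 = 1 / 2 * M by push_cast; ring]
    ring
  have hmp : MeasurePreserving (fun x : EuclideanSpace ℝ (Fin (M + 1)) =>
      WithLp.ofLp (b.repr x)) volume volume :=
    (PiLp.volume_preserving_ofLp (Fin (M + 1))).comp b.measurePreserving_repr
  have hmeas : ∀ i, Measurable (g i) := fun i => by simp only [hg]; fun_prop
  have hmeas' : Measurable fun x : Fin (M + 1) → ℝ => ENNReal.ofReal (∏ i, g i (x i)) :=
    (Finset.measurable_fun_prod _ fun i _ => (hmeas i).comp (measurable_pi_apply i)).ennreal_ofReal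
  have hq0 : 0 ≤ ‖q‖ ^ (2 * n) := by positivity
  simp_rw [hprod, ENNReal.ofReal_mul hq0]
  rw [lintegral_const_mul' _ _ ENNReal.ofReal_ne_top, mul_assoc, mul_assoc (‖q‖ ^ (2 * n)),
    ENNReal.ofReal_mul hq0, ← mul_assoc (Real.pi ^ _), ← hval]
  congr 1
  rw [hmp.lintegral_comp hmeas', ← integral_fintype_prod_volume_eq_prod,
    ofReal_integral_eq_lintegral_ofReal]
  · exact Integrable.fintype_prod hgi
  · exact ae_of_all _ fun x => Finset.prod_nonneg fun i _ =>
      mul_nonneg ((even_two_mul _).pow_nonneg _) (Real.exp_nonneg _)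

theorem lintegral_euclidean_moment {M : ℕ} (hM : 0 < M) (q : EuclideanSpace ℝ (Fin M)) (n : ℕ)
    {N C : ℝ} (hN : n + (M : ℝ) / 2 < N) (hC : 0 < C) :
    ∫⁻ x : EuclideanSpace ℝ (Fin M),
        ENNReal.ofReal ((inner ℝ x q) ^ (2 * n) * (‖x‖ ^ 2 + C) ^ (-N)) =
      ENNReal.ofReal (‖q‖ ^ (2 * n) * Real.pi ^ (((M : ℝ) - 1) / 2) * Real.Gamma (n + 1 / 2) *
        (Real.Gamma (N - (n + M / 2)) / Real.Gamma N) * C ^ ((n + (M : ℝ) / 2) - N)) := by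
  have hg : 0 < Real.Gamma ((n : ℝ) + 1 / 2) := Real.Gamma_pos_of_pos (by positivity)
  have hpi := Real.pi_pos
  have h0 : 0 ≤ (n : ℝ) + M / 2 := by positivity
  exact lintegral_mul_add_rpow_of_moment
    (g := fun x : EuclideanSpace ℝ (Fin M) => (inner ℝ x q) ^ (2 * n)) (h := fun x => ‖x‖ ^ 2)
    (by fun_prop) (by fun_prop) (ae_of_all _ fun x => (even_two_mul n).pow_nonneg _)
    (ae_of_all _ fun x => sq_nonneg _) (by positivity) (h0.trans_lt hN) hN hC
    fun t ht => lintegral_euclidean_gaussian_moment hM q n ht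

theorem lintegral_euclidean_inner {N : ℕ} (hN : 0 < N) (hN4 : (N : ℝ) < 4)
    (p : EuclideanSpace ℝ (Fin N)) {κ₁ κ₂ : ℝ} (h1 : 0 < κ₁) (h2 : 0 < κ₂) :
    ∫⁻ x : EuclideanSpace ℝ (Fin N),
        ENNReal.ofReal (1 / (‖x‖ ^ 2 + κ₁ ^ 2) * (1 / (‖x + p‖ ^ 2 + κ₂ ^ 2))) =
      ENNReal.ofReal (Real.pi ^ ((N : ℝ) / 2) * Real.Gamma ((4 - N) / 2) *
        massIntegral ((4 - N) / 2) ‖p‖ κ₁ κ₂) := by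
  have hm1 : Measurable (fun s => feynmanMass ‖p‖ κ₁ κ₂ s) :=
    (continuous_feynmanMass _ κ₁ κ₂).measurable
  have hgl : 0 < Real.Gamma ((4 - (N : ℝ)) / 2) := Real.Gamma_pos_of_pos (by linarith)
  have hpi := Real.pi_pos
  calc _ = ∫⁻ x : EuclideanSpace ℝ (Fin N), ∫⁻ s in Ioc (0 : ℝ) 1, ENNReal.ofReal
        ((‖x + (1 - s) • p‖ ^ 2 + feynmanMass ‖p‖ κ₁ κ₂ s) ^ (-2 : ℝ)) := by
        refine lintegral_congr fun x => ?_
        rw [← lintegral_feynman_two (by positivity) (by positivity)]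
        refine lintegral_congr fun s => ?_
        congr 2
        rw [feynmanMass, norm_add_sq_real, norm_add_sq_real, norm_smul, real_inner_smul_right,
          mul_pow, Real.norm_eq_abs, sq_abs]
        ring
    _ = ∫⁻ s in Ioc (0 : ℝ) 1, ∫⁻ x : EuclideanSpace ℝ (Fin N), ENNReal.ofReal
        ((‖x + (1 - s) • p‖ ^ 2 + feynmanMass ‖p‖ κ₁ κ₂ s) ^ (-2 : ℝ)) := by
        refine lintegral_lintegral_swap ?_
        refine Measurable.aemeasurable ?_
        fun_prop
    _ = ∫⁻ s in Ioc (0 : ℝ) 1, ENNReal.ofReal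
          (Real.pi ^ ((N : ℝ) / 2) * Real.Gamma ((4 - N) / 2)) *
          ENNReal.ofReal (feynmanMass ‖p‖ κ₁ κ₂ s ^ (-((4 - (N : ℝ)) / 2))) := by
        refine setLIntegral_congr_fun measurableSet_Ioc fun s hs => ?_
        have hF := feynmanMass_pos ‖p‖ h1 h2 (Ioc_subset_Icc_self hs)
        -- The case `n = 0`, in which the direction vector plays no role and may be zero.
        have h := lintegral_euclidean_moment hN 0 0 (N := 2) (C := feynmanMass ‖p‖ κ₁ κ₂ s)
          (by push_cast; linarith) hF
        simp only [mul_zero, pow_zero, one_mul, Nat.cast_zero, zero_add,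
          Real.Gamma_one_half_eq, Real.Gamma_two, div_one] at h
        rw [show 2 - (N : ℝ) / 2 = (4 - N) / 2 by ring,
          show (N : ℝ) / 2 - 2 = -((4 - N) / 2) by ring] at h
        rw [lintegral_add_right_eq_self (fun x : EuclideanSpace ℝ (Fin N) =>
          ENNReal.ofReal ((‖x‖ ^ 2 + feynmanMass ‖p‖ κ₁ κ₂ s) ^ (-2 : ℝ))), h,
          ← ENNReal.ofReal_mul (by positivity)]
        congr 3
        rw [Real.sqrt_eq_rpow, ← Real.rpow_add hpi]
        congr 1; ring
    _ = _ := by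
        rw [lintegral_const_mul _ (by fun_prop), lintegral_feynmanMass_rpow _ _ h1 h2,
          ← ENNReal.ofReal_mul (by positivity)]

/-! ### Termwise integration over the outer momentum in integer dimension -/

section Euclidean

variable {N M : ℕ} {p : EuclideanSpace ℝ (Fin N)} {q : EuclideanSpace ℝ (Fin M)}

/-- The `(k, n)` term of the expansion of the inner integral as a function of `q'`. -/
noncomputable def euclideanTerm (l p : ℝ) (q : EuclideanSpace ℝ (Fin M)) (j : ℕ × ℕ)
    (x : EuclideanSpace ℝ (Fin M)) : ℝ :=
  massTerm l p (‖x + (1 / 2 : ℝ) • q‖ ^ 2 + ‖q‖ ^ 2 / 4) (-(inner ℝ (x + (1 / 2 : ℝ) • q) q)) j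

theorem euclideanTerm_eq (l p : ℝ) (q : EuclideanSpace ℝ (Fin M)) (j : ℕ × ℕ) :
    euclideanTerm l p q j = fun x => massCoeff l j.1 j.2 * (-(p ^ 2 / 4)) ^ j.1 *
      ((inner ℝ (x + (1 / 2 : ℝ) • q) q) ^ (2 * j.2) *
        (‖x + (1 / 2 : ℝ) • q‖ ^ 2 + ‖q‖ ^ 2 / 4) ^ (-(2 * (l + j.1 + j.2)))) := by
  ext x
  rw [euclideanTerm, massTerm, (even_two_mul j.2).neg_pow]
  ring

theorem hasSum_euclideanTerm {l : ℝ} (hl : 0 < l) (hl2 : l < 2) {p : ℝ} (hq : q ≠ 0)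
    (hX : bigX p ‖q‖ < 1) {x : EuclideanSpace ℝ (Fin M)} (h1 : x ≠ 0) (h2 : x + q ≠ 0) :
    HasSum (fun j => euclideanTerm l p q j x) (massIntegral l p (‖x‖ ^ 2) (‖x + q‖ ^ 2)) := by
  have hS : (‖x‖ ^ 2 + ‖x + q‖ ^ 2) / 2 = ‖x + (1 / 2 : ℝ) • q‖ ^ 2 + ‖q‖ ^ 2 / 4 := by
    rw [norm_add_sq_real, norm_add_sq_real, norm_smul, real_inner_smul_right, mul_pow,
      Real.norm_eq_abs, sq_abs]
    ring
  have hδ : (‖x‖ ^ 2 - ‖x + q‖ ^ 2) / 2 = -(inner ℝ (x + (1 / 2 : ℝ) • q) q) := by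
    rw [norm_add_sq_real, inner_add_left, real_inner_smul_left, real_inner_self_eq_norm_sq]
    ring
  have hp := sq_lt_of_bigX_lt_one (norm_pos_iff.2 hq) hX
    (S := ‖x + (1 / 2 : ℝ) • q‖ ^ 2 + ‖q‖ ^ 2 / 4) (by nlinarith [sq_nonneg ‖x + (1 / 2 : ℝ) • q‖])
  have hn1 := norm_pos_iff.2 h1
  have hn2 := norm_pos_iff.2 h2
  have h := hasSum_massTerm hl hl2 (p := p) (κ₁ := ‖x‖ ^ 2) (κ₂ := ‖x + q‖ ^ 2) (by positivity)
    (by positivity) (by rw [← hS] at hp; linarith)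
  rw [hS, hδ] at h
  exact h

theorem integrable_and_integral_euclidean_weight {l : ℝ} (hl : 0 < l) (hM : 0 < M)
    (ha : 0 < 2 * l - (M : ℝ) / 2) (hq : q ≠ 0) (j : ℕ × ℕ) :
    Integrable (fun x : EuclideanSpace ℝ (Fin M) =>
      (inner ℝ (x + (1 / 2 : ℝ) • q) q) ^ (2 * j.2) *
        (‖x + (1 / 2 : ℝ) • q‖ ^ 2 + ‖q‖ ^ 2 / 4) ^ (-(2 * (l + j.1 + j.2)))) ∧
    ∫ x : EuclideanSpace ℝ (Fin M), (inner ℝ (x + (1 / 2 : ℝ) • q) q) ^ (2 * j.2) *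
        (‖x + (1 / 2 : ℝ) • q‖ ^ 2 + ‖q‖ ^ 2 / 4) ^ (-(2 * (l + j.1 + j.2))) =
      Real.pi ^ (((M : ℝ) - 1) / 2) * momentWeight l (2 * l - (M : ℝ) / 2) ‖q‖ j := by
  have hq0 := norm_pos_iff.2 hq
  have hw := momentWeight_pos hl ha hq0 j
  have hpi := Real.pi_pos
  refine integrable_and_integral_eq_of_lintegral ?_ ?_ (by positivity) ?_
  · refine Measurable.aestronglyMeasurable ?_
    fun_prop
  · refine ae_of_all _ fun x => ?_
    have h2 : 0 ≤ (inner ℝ (x + (1 / 2 : ℝ) • q) q) ^ (2 * j.2) := (even_two_mul _).pow_nonneg _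
    simp only [Pi.zero_apply]
    positivity
  · have hk : (0 : ℝ) ≤ j.1 := j.1.cast_nonneg
    have hn : (0 : ℝ) ≤ j.2 := j.2.cast_nonneg
    rw [lintegral_add_right_eq_self (fun x : EuclideanSpace ℝ (Fin M) =>
      ENNReal.ofReal ((inner ℝ x q) ^ (2 * j.2) *
        (‖x‖ ^ 2 + ‖q‖ ^ 2 / 4) ^ (-(2 * (l + j.1 + j.2))))),
      lintegral_euclidean_moment hM q j.2 (by linarith) (by positivity), momentWeight,
      show 2 * (l + j.1 + j.2) - ((j.2 : ℝ) + M / 2) =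
        2 * l - (M : ℝ) / 2 + (j.2 + 2 * j.1 : ℕ) by push_cast; ring,
      show (j.2 : ℝ) + M / 2 - 2 * (l + j.1 + j.2) =
        -(2 * l - (M : ℝ) / 2 + (j.2 + 2 * j.1 : ℕ)) by push_cast; ring]
    congr 1
    ring

theorem euclidean_integrable_and_hasSum {D : ℝ} (hD : 0 < D) (hD4 : D < 4) (hM : 0 < M)
    (ha : 0 < parA D M) (ha2 : parA D M < 2) {p : ℝ} (hq : q ≠ 0) (hX : bigX p ‖q‖ < 1) :
    Integrable (fun x : EuclideanSpace ℝ (Fin M) =>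
      massIntegral ((4 - D) / 2) p (‖x‖ ^ 2) (‖x + q‖ ^ 2)) ∧
    HasSum (fun j : ℕ × ℕ => Real.pi ^ (((M : ℝ) - 1) / 2) *
        (seriesConst D M ‖q‖ * doubleTerm D M (bigX p ‖q‖) j.2 j.1))
      (∫ x : EuclideanSpace ℝ (Fin M),
        massIntegral ((4 - D) / 2) p (‖x‖ ^ 2) (‖x + q‖ ^ 2)) := by
  have hl : 0 < (4 - D) / 2 := by linarith
  have hq0 := norm_pos_iff.2 hq
  have hpi := Real.pi_pos
  have hMr : (0 : ℝ) < M := by exact_mod_cast hM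
  have hwt := fun j => integrable_and_integral_euclidean_weight hl hM (by rwa [← parA_eq]) hq j
  have hint : ∀ j, ∫ x, euclideanTerm ((4 - D) / 2) p q j x = Real.pi ^ (((M : ℝ) - 1) / 2) *
        (seriesConst D M ‖q‖ * doubleTerm D M (bigX p ‖q‖) j.2 j.1) := by
    intro j
    rw [euclideanTerm_eq, integral_const_mul, (hwt j).2, seriesConst,
      ← massCoeff_mul_momentWeight hD4 ha hq0, parA_eq]
    ring
  have h := integrable_and_hasSum_integral (F := euclideanTerm ((4 - D) / 2) p q)
    (f := fun x : EuclideanSpace ℝ (Fin M) =>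
      massIntegral ((4 - D) / 2) p (‖x‖ ^ 2) (‖x + q‖ ^ 2)) (ν := volume) ?_ ?_ ?_
  · simp_rw [hint] at h
    exact h
  · intro j
    rw [euclideanTerm_eq]
    exact (hwt j).1.const_mul _
  · have hnorm : ∀ j, ∫ x, ‖euclideanTerm ((4 - D) / 2) p q j x‖ =
        |Real.pi ^ (((M : ℝ) - 1) / 2) *
        (seriesConst D M ‖q‖ * doubleTerm D M (bigX p ‖q‖) j.2 j.1)| := by
      intro j
      rw [← hint, euclideanTerm_eq, integral_const_mul, abs_mul,
        abs_of_nonneg (a := ∫ x, _ ∂_), ← integral_const_mul]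
      · refine integral_congr_ae (ae_of_all _ fun x => ?_)
        have h2 : 0 ≤ (inner ℝ (x + (1 / 2 : ℝ) • q) q) ^ (2 * j.2) :=
          (even_two_mul _).pow_nonneg _
        simp only
        rw [Real.norm_eq_abs, abs_mul]
        congr 1
        exact abs_of_nonneg (by positivity)
      · rw [(hwt j).2, ← parA_eq]
        have hw := momentWeight_pos hl ha hq0 j
        positivity
    simp_rw [hnorm, abs_mul]
    exact ((summable_abs_doubleTerm_swap hD hD4 hMr ha ha2 hX).mul_left _).mul_left _
  -- The expansion fails only where a mass vanishes, at `0` and `-q`, and points are null sets in a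
  -- nontrivial space.
  · have : Nontrivial (EuclideanSpace ℝ (Fin M)) := ⟨q, 0, hq⟩
    filter_upwards [Measure.ae_ne volume (0 : EuclideanSpace ℝ (Fin M)),
      Measure.ae_ne volume (-q)] with x h1 h2
    exact hasSum_euclideanTerm hl (by linarith) hq hX h1 fun h => h2 (eq_neg_of_add_eq_zero_left h)

theorem ae_norm_pos_and_norm_add_pos (hq : q ≠ 0) :
    ∀ᵐ x : EuclideanSpace ℝ (Fin M), 0 < ‖x‖ ∧ 0 < ‖x + q‖ := by
  have : Nontrivial (EuclideanSpace ℝ (Fin M)) := ⟨q, 0, hq⟩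
  filter_upwards [Measure.ae_ne volume (0 : EuclideanSpace ℝ (Fin M)),
    Measure.ae_ne volume (-q)] with x h1 h2
  exact ⟨norm_pos_iff.2 h1, norm_pos_iff.2 fun h => h2 (eq_neg_of_add_eq_zero_left h)⟩

theorem euclideanIntegrand_eq (x : EuclideanSpace ℝ (Fin M)) (y : EuclideanSpace ℝ (Fin N)) :
    euclideanIntegrand p q (x, y) =
      1 / (‖y‖ ^ 2 + (‖x‖ ^ 2) ^ 2) * (1 / (‖y + p‖ ^ 2 + (‖x + q‖ ^ 2) ^ 2)) := by
  simp only [euclideanIntegrand, ← pow_mul]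

theorem integral_euclideanIntegrand (hN : 0 < N) (hN4 : (N : ℝ) < 4)
    {x : EuclideanSpace ℝ (Fin M)} (h1 : 0 < ‖x‖) (h2 : 0 < ‖x + q‖) :
    ∫ y, euclideanIntegrand p q (x, y) = Real.pi ^ ((N : ℝ) / 2) * Real.Gamma ((4 - N) / 2) *
      massIntegral ((4 - N) / 2) ‖p‖ (‖x‖ ^ 2) (‖x + q‖ ^ 2) := by
  have hgl : 0 < Real.Gamma ((4 - (N : ℝ)) / 2) := Real.Gamma_pos_of_pos (by linarith)
  have hmi := massIntegral_nonneg ((4 - (N : ℝ)) / 2) ‖p‖ (pow_pos h1 2) (pow_pos h2 2)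
  have hpi := Real.pi_pos
  simp_rw [euclideanIntegrand_eq]
  refine (integrable_and_integral_eq_of_lintegral ?_ (ae_of_all _ fun y => ?_) (by positivity)
    (lintegral_euclidean_inner hN hN4 p (pow_pos h1 2) (pow_pos h2 2))).2
  · refine Measurable.aestronglyMeasurable ?_
    fun_prop
  · simp only [Pi.zero_apply]; positivity

/-- By Tonelli it suffices that the inner integral, a multiple of `massIntegral`, is integrable in
`q'`, which the termwise integration has shown. -/
theorem integrable_euclideanIntegrand (hN : 0 < N) (hN4 : (N : ℝ) < 4) (hM : 0 < M)
    (ha : 0 < parA N M) (ha2 : parA N M < 2) (hq : q ≠ 0) (hX : bigX ‖p‖ ‖q‖ < 1) :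
    Integrable (euclideanIntegrand p q) := by
  have h := (euclidean_integrable_and_hasSum (by exact_mod_cast hN) hN4 hM ha ha2 hq hX).1.const_mul
    (Real.pi ^ ((N : ℝ) / 2) * Real.Gamma ((4 - N) / 2))
  have hm : Measurable (euclideanIntegrand p q) := by unfold euclideanIntegrand; fun_prop
  have h0 : ∀ z, 0 ≤ euclideanIntegrand p q z := fun z => by
    unfold euclideanIntegrand; positivity
  refine ⟨hm.aestronglyMeasurable, ?_⟩
  rw [hasFiniteIntegral_iff_ofReal (ae_of_all _ h0), Measure.volume_eq_prod,
    lintegral_prod _ hm.ennreal_ofReal.aemeasurable]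
  refine lt_of_eq_of_lt (lintegral_congr_ae ?_) h.lintegral_lt_top
  filter_upwards [ae_norm_pos_and_norm_add_pos hq] with x hx
  simp_rw [euclideanIntegrand_eq]
  exact lintegral_euclidean_inner hN hN4 p (pow_pos hx.1 2) (pow_pos hx.2 2)

theorem euclideanLoopIntegral_eq (hN : 0 < N) (hN4 : (N : ℝ) < 4) (hM : 0 < M)
    (ha : 0 < parA N M) (ha2 : parA N M < 2) (hq : q ≠ 0) (hX : bigX ‖p‖ ‖q‖ < 1) :
    euclideanLoopIntegral p q = coeffA N M * ‖q‖ ^ (-4 + 2 * eps N M) *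
      ∑' n : ℕ, coeffB N M n *
        hyp32 1 ((parA N M + n) / 2) ((parA N M + n + 1) / 2)
          (3 / 2 + n) (parB N + 1 + n) (-bigX ‖p‖ ‖q‖) := by
  have hNr : (0 : ℝ) < N := by exact_mod_cast hN
  have hMr : (0 : ℝ) < M := by exact_mod_cast hM
  have hsum := (euclidean_integrable_and_hasSum hNr hN4 hM ha ha2 hq hX).2.tsum_eq
  rw [tsum_mul_left, tsum_mul_left, tsum_doubleTerm_swap hNr hN4 hMr ha ha2 hX] at hsum
  have hin : ∀ᵐ x : EuclideanSpace ℝ (Fin M),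
      1 / (2 * Real.pi) ^ N * ∫ y, euclideanIntegrand p q (x, y) =
      innerConst N * massIntegral ((4 - N) / 2) ‖p‖ (‖x‖ ^ 2) (‖x + q‖ ^ 2) := by
    filter_upwards [ae_norm_pos_and_norm_add_pos hq] with x hx
    rw [integral_euclideanIntegrand hN hN4 hx.1 hx.2, innerConst, Real.rpow_natCast]
    ring
  rw [euclideanLoopIntegral, integral_congr_ae hin, integral_const_mul, ← hsum,
    ← loop_constant hN4 (norm_pos_iff.2 hq), innerConst, seriesConst, Real.rpow_natCast _ M]
  ring

end Euclidean

end AnisotropicLoop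

theorem theorem3 (D m : ℝ) (hD : 0 < D) (hm : 0 < m)
    (hlow : 0 < eps D m) (hup : eps D m < 2) :
    (∀ X : ℝ, 0 ≤ X → X < 1 →
      (∀ n : ℕ, Summable (hyp32Term 1 ((parA D m + n) / 2) ((parA D m + n + 1) / 2)
        (3 / 2 + n) (parB D + 1 + n) (-X))) ∧
      Summable (fun n : ℕ => coeffB D m n *
        hyp32 1 ((parA D m + n) / 2) ((parA D m + n + 1) / 2)
          (3 / 2 + n) (parB D + 1 + n) (-X))) ∧
    (∀ p q : ℝ, 0 ≤ p → 0 < q → bigX p q < 1 →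
      LoopConvergent D m p q ∧
      loopIntegral D m p q =
        coeffA D m * q ^ (-4 + 2 * eps D m) *
          ∑' n : ℕ, coeffB D m n *
            hyp32 1 ((parA D m + n) / 2) ((parA D m + n + 1) / 2)
              (3 / 2 + n) (parB D + 1 + n) (-bigX p q)) ∧
    (∀ N M : ℕ, (N : ℝ) = D → (M : ℝ) = m →
      ∀ (p : EuclideanSpace ℝ (Fin N)) (q : EuclideanSpace ℝ (Fin M)),
        q ≠ 0 → bigX ‖p‖ ‖q‖ < 1 →
        Integrable (euclideanIntegrand p q) ∧
        euclideanLoopIntegral p q =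
          coeffA D m * ‖q‖ ^ (-4 + 2 * eps D m) *
            ∑' n : ℕ, coeffB D m n *
              hyp32 1 ((parA D m + n) / 2) ((parA D m + n + 1) / 2)
                (3 / 2 + n) (parB D + 1 + n) (-bigX ‖p‖ ‖q‖)) := by
  -- The window for `ε` enters through three bounds: `a > 0` for the outer moments, `a < 2` for the
  -- sum of the `B_n`, and `D < 4` for the inner integral.
  have ha : 0 < parA D m := by unfold parA; unfold eps at hup; linarith
  have ha2 : parA D m < 2 := by unfold parA; unfold eps at hlow; linarith
  have hD4 : D < 4 := by unfold eps at hup; linarith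
  refine ⟨fun X hX hX1 => ⟨summable_hyp32Term_param hD4 hm ha ha2 hX hX1,
    (hasSum_doubleTerm hD hD4 hm ha ha2 hX hX1).summable⟩,
    fun p q _ hq hX => ⟨loopConvergent hD hD4 hm ha ha2 hq hX,
      loopIntegral_eq hD hD4 hm ha ha2 hq hX⟩, ?_⟩
  rintro N M rfl rfl p q hq hX
  have hN : 0 < N := by exact_mod_cast hD
  have hM : 0 < M := by exact_mod_cast hm
  exact ⟨integrable_euclideanIntegrand hN hD4 hM ha ha2 hq hX,
    euclideanLoopIntegral_eq hN hD4 hM ha ha2 hq hX⟩
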